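/- An instance of delegated stochastic probing consists of a finite set $E$, independent random pairs $(X_e,Y_e)$ for $e\in E$ with values in $\mathbb{R}_{\ge 0}\times\mathbb{R}_{\ge 0}$ and laws $\mu_e$ (the utilities of a principal and of an agent), and two downwards-closed families $\mathcal{I}_{\mathrm{out}},\mathcal{I}_{\mathrm{in}}\subseteq 2^E$ (outer and inner constraint). Assume $\mathbb{E}\,Y_e<\infty$ for all $e$. Write $x(G)=\sum_{e\in G}X_e$, $y(G)=\sum_{e\in G}Y_e$ and $\Omega_G=\{(e,X_e,Y_e):e\in G\}$ for $G\subseteq E$. A probing strategy probes elements adaptively, one at a time and each at most once, observing $(X_e,Y_e)$ when it probes $e$; the set of probed elements must stay in $\mathcal{I}_{\mathrm{out}}$. Let $\mathrm{OPT}$ be the supremum, over all probing strategies, of $\mathbb{E}\max\{x(G): G\subseteq F,\ G\in\mathcal{I}_{\mathrm{in}}\}$, where $F$ is the random set of probed elements. A deterministic policy is a (measurable) family $\mathcal{R}$ of finite sets $T$ of triples $(e,x,y)$ with $(x,y)\in\operatorname{supp}\mu_e$, such that the triples in $T$ have distinct first components and the set of these belongs to $\mathcal{I}_{\mathrm{in}}$.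 Knowing $\mathcal{R}$, the agent follows a probing strategy and then proposes a set $G\subseteq E$. If all elements of $G$ were probed and $\Omega_G\in\mathcal{R}$, then $G$ is accepted, and the principal and the agent receive $x(G)$ and $y(G)$; otherwise nothing is accepted (the accepted set is $\emptyset$) and both receive $0$. A best response is a strategy of the agent (probing and proposing) that maximizes his expected utility. It is diligent if almost surely: only elements that occur in some member of $\mathcal{R}$ are probed; probing ends only when no further such element can be probed within $\mathcal{I}_{\mathrm{out}}$; and the accepted set is not properly contained in another set $G$ of probed elements with $\Omega_G\in\mathcal{R}$. An agent response to $\mathcal{R}$ is any best response if $Y_e>0$ almost surely for every $e\in E$, and any diligent best response in general. The policy $\mathcal{R}$ is an $\alpha$-policy if an agent response to it exists and if, for every agent response, the expected utility of the principal is at least $\alpha\cdot\mathrm{OPT}$. **Corollary.** If $\mathcal{I}_{\mathrm{out}}$ and $\mathcal{I}_{\mathrm{in}}$ are the families of independent sets of two matroids on $E$, then the instance has a deterministic $\frac14\left(1-\frac1e\right)$-policy. -/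

import Mathlib

open MeasureTheory
open scoped NNReal ENNReal

namespace Delegation

/-- A downwards-closed set system on the finite ground set `E`. -/
structure SetSystem (E : Type*) where
  feasible : Finset E → Prop
  empty_feasible : feasible ∅
  down_closed : ∀ S T : Finset E, S ⊆ T → feasible T → feasible S

/-- The set system is (the family of independent sets of) a matroid with ground set `E`. -/
def SetSystem.IsMatroid {E : Type*} (M : SetSystem E) : Prop :=
  ∃ N : Matroid E, N.E = Set.univ ∧ ∀ S : Finset E, M.feasible S ↔ N.Indep (S : Set E)

/-- A pair `(x, y)` of utilities for the principal and for the agent. -/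
abbrev Utilities : Type := ℝ≥0 × ℝ≥0

/-- An outcome `(e, x, y)`. -/
abbrev Outcome (E : Type*) : Type _ := E × Utilities

/-- An instance of delegated stochastic probing. Elements are independent: the joint law is the
product of the laws `law e` of the pairs `(X_e, Y_e)`, see `Instance.prob`. -/
structure Instance (E : Type*) where
  law : E → ProbabilityMeasure Utilities
  outer : SetSystem E
  inner : SetSystem E

/-- An adaptive strategy as a decision tree: either end by putting forward a set of elements, or
probe an element and continue depending on the utilities that are observed. -/
inductive Strategy (E : Type*) where
  | propose (G : Finset E) : Strategy E
  | probe (e : E) (next : Utilities → Strategy E) : Strategy E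

namespace Strategy

variable {E : Type*} [DecidableEq E]

/-- The set of elements that the strategy probes when the realized utilities are `ω`. -/
def probed : Strategy E → (E → Utilities) → Finset E
  | propose _, _ => ∅
  | probe e next, ω => insert e ((next (ω e)).probed ω)

/-- The set of elements that the strategy puts forward when the realized utilities are `ω`. -/
def proposal : Strategy E → (E → Utilities) → Finset E
  | propose G, _ => G
  | probe e next, ω => (next (ω e)).proposal ω

/-- Having probed `F` already, the strategy probes no element twice and the set of probed elements
always stays feasible for `M`. -/
def FeasibleFrom (M : SetSystem E) : Finset E → Strategy E → Prop
  | _, propose _ => True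
  | F, probe e next =>
      e ∉ F ∧ M.feasible (insert e F) ∧ ∀ v, FeasibleFrom M (insert e F) (next v)

/-- The strategy depends measurably on the realized utilities. -/
def IsMeasurable (σ : Strategy E) : Prop :=
  (∀ F : Finset E, MeasurableSet {ω | σ.probed ω = F}) ∧
    ∀ G : Finset E, MeasurableSet {ω | σ.proposal ω = G}

end Strategy

/-- `x(G) = ∑_{e ∈ G} X_e` in the state `ω`. -/
noncomputable def xUtil {E : Type*} (G : Finset E) (ω : E → Utilities) : ℝ≥0∞ :=
  ∑ e ∈ G, ((ω e).1 : ℝ≥0∞)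

/-- `y(G) = ∑_{e ∈ G} Y_e` in the state `ω`. -/
noncomputable def yUtil {E : Type*} (G : Finset E) (ω : E → Utilities) : ℝ≥0∞ :=
  ∑ e ∈ G, ((ω e).2 : ℝ≥0∞)

/-- `Ω_G`: the set of realized outcomes of the elements of `G` in the state `ω`. -/
def outcomes {E : Type*} [DecidableEq E] (G : Finset E) (ω : E → Utilities) :
    Finset (Outcome E) :=
  G.map ⟨fun e => (e, ω e), fun _ _ h => congrArg Prod.fst h⟩

/-- The elements that occur in some set of the family `R`. -/
def relevant {E : Type*} (R : Set (Finset (Outcome E))) : Set E :=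
  {e | ∃ T ∈ R, ∃ o ∈ T, o.1 = e}

open Classical in
/-- The set of elements that the principal accepts from the strategy `σ` under policy `R`: the
proposed set if all its elements were probed and its set of outcomes is in `R`. Otherwise nothing
is accepted (and both players receive `0`). -/
noncomputable def accepted {E : Type*} [DecidableEq E] (R : Set (Finset (Outcome E)))
    (σ : Strategy E) (ω : E → Utilities) : Finset E :=
  if σ.proposal ω ⊆ σ.probed ω ∧ outcomes (σ.proposal ω) ω ∈ R then σ.proposal ω else ∅

namespace Instance

variable {E : Type*} [Fintype E] [DecidableEq E] (I : Instance E)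

/-- The joint law of all utilities. -/
noncomputable def prob : Measure (E → Utilities) :=
  Measure.pi fun e => (I.law e : Measure Utilities)

/-- The adaptive strategies allowed by the outer constraint. -/
def IsStrategy (σ : Strategy E) : Prop :=
  σ.FeasibleFrom I.outer ∅ ∧ σ.IsMeasurable

/-- `u(F)`: the largest `x(G)` over the sets `G ⊆ F` that are feasible for the inner constraint. -/
noncomputable def u (F : Finset E) (ω : E → Utilities) : ℝ≥0∞ :=
  ⨆ (G : Finset E) (_ : G ⊆ F ∧ I.inner.feasible G), xUtil G ω

/-- The optimal expected utility of the non-delegating principal. -/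
noncomputable def nonDelegatedValue : ℝ≥0∞ :=
  ⨆ (σ : Strategy E) (_ : I.IsStrategy σ), ∫⁻ ω, I.u (σ.probed ω) ω ∂I.prob

/-- `Ω_in`: sets of outcomes of distinct elements, with utilities in the support of their laws,
whose set of elements is feasible for the inner constraint. -/
def innerOutcomes : Set (Finset (Outcome E)) :=
  {T | (∀ o ∈ T, o.2 ∈ (I.law o.1 : Measure Utilities).support) ∧
    Set.InjOn Prod.fst (T : Set (Outcome E)) ∧ I.inner.feasible (T.image Prod.fst)}

/-- A deterministic (single-proposal) policy: a measurable family of sets in `Ω_in`. -/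
def IsPolicy (R : Set (Finset (Outcome E))) : Prop :=
  R ⊆ I.innerOutcomes ∧ ∀ G : Finset E, MeasurableSet {ω | outcomes G ω ∈ R}

/-- Expected utility of the agent who plays `σ` against the policy `R`. -/
noncomputable def agentValue (R : Set (Finset (Outcome E))) (σ : Strategy E) : ℝ≥0∞ :=
  ∫⁻ ω, yUtil (accepted R σ ω) ω ∂I.prob

/-- Expected utility of the principal with policy `R` when the agent plays `σ`. -/
noncomputable def principalValue (R : Set (Finset (Outcome E))) (σ : Strategy E) : ℝ≥0∞ :=
  ∫⁻ ω, xUtil (accepted R σ ω) ω ∂I.prob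

/-- `σ` maximizes the agent's expected utility against `R`. -/
def IsBestResponse (R : Set (Finset (Outcome E))) (σ : Strategy E) : Prop :=
  I.IsStrategy σ ∧ ∀ τ, I.IsStrategy τ → I.agentValue R τ ≤ I.agentValue R σ

/-- The agent's utility of every element is almost surely positive. -/
def AgentPositive : Prop :=
  ∀ e, ∀ᵐ v ∂(I.law e : Measure Utilities), 0 < v.2

/-- Almost surely, the agent probes only elements that occur in acceptable sets, does not end while
a further such element can be probed, and has a set accepted that is not properly contained in
another acceptable set of probed outcomes (if none is accepted, there is no acceptable set of probed
outcomes). The order of probing and the choice among inclusion-maximal sets are not restricted. -/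
def IsDiligent (R : Set (Finset (Outcome E))) (σ : Strategy E) : Prop :=
  ∀ᵐ ω ∂I.prob,
    (∀ e ∈ σ.probed ω, e ∈ relevant R) ∧
    (∀ e ∈ relevant R, e ∉ σ.probed ω → ¬ I.outer.feasible (insert e (σ.probed ω))) ∧
    ∀ G : Finset E, G ⊆ σ.probed ω → outcomes G ω ∈ R → accepted R σ ω ⊆ G →
      accepted R σ ω = G

/-- The possible behaviours of the agent: any best response at all if the agent's utilities are
positive; if they may vanish, any diligent best response. -/
def IsAgentResponse (R : Set (Finset (Outcome E))) (σ : Strategy E) : Prop :=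
  I.IsBestResponse R σ ∧ (I.AgentPositive ∨ I.IsDiligent R σ)

/-- `R` is a deterministic `α`-policy: the agent has a response, and against every response the
principal's expected utility is at least `α` times her optimal non-delegated one. -/
def IsAlphaPolicy (α : ℝ) (R : Set (Finset (Outcome E))) : Prop :=
  I.IsPolicy R ∧ (∃ σ, I.IsAgentResponse R σ) ∧
    ∀ σ, I.IsAgentResponse R σ → ENNReal.ofReal α * I.nonDelegatedValue ≤ I.principalValue R σ

end Instance

end Delegation

namespace Delegation

section MultilinearExtension

variable {E : Type*} [Fintype E] [DecidableEq E]

/-- The multilinear extension of a set function: the expected value of `f` at the random set that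
contains each `e` independently with probability `q e`. -/
def multilinearExt (f : Finset E → ℝ) (q : E → ℝ) : ℝ :=
  ∑ Q : Finset E, (∏ e, if e ∈ Q then q e else 1 - q e) * f Q

theorem multilinearExt_mono {f g : Finset E → ℝ} {q : E → ℝ} (h0 : ∀ e, 0 ≤ q e)
    (h1 : ∀ e, q e ≤ 1) (h : ∀ Q, f Q ≤ g Q) : multilinearExt f q ≤ multilinearExt g q := by
  refine Finset.sum_le_sum fun Q _ => mul_le_mul_of_nonneg_left (h Q) (Finset.prod_nonneg ?_)
  intro e _
  split_ifs
  · exact h0 e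
  · linarith [h1 e]

theorem multilinearExt_add (f g : Finset E → ℝ) (q : E → ℝ) :
    multilinearExt (fun Q => f Q + g Q) q = multilinearExt f q + multilinearExt g q := by
  simp only [multilinearExt, mul_add, Finset.sum_add_distrib]

theorem multilinearExt_sub (f g : Finset E → ℝ) (q : E → ℝ) :
    multilinearExt (fun Q => f Q - g Q) q = multilinearExt f q - multilinearExt g q := by
  simp only [multilinearExt, mul_sub, Finset.sum_sub_distrib]

theorem multilinearExt_const_mul (c : ℝ) (f : Finset E → ℝ) (q : E → ℝ) :
    multilinearExt (fun Q => c * f Q) q = c * multilinearExt f q := by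
  simp only [multilinearExt, Finset.mul_sum]
  exact Finset.sum_congr rfl fun Q _ => by ring

theorem multilinearExt_sum {ι : Type*} (s : Finset ι) (f : ι → Finset E → ℝ) (q : E → ℝ) :
    multilinearExt (fun Q => ∑ i ∈ s, f i Q) q = ∑ i ∈ s, multilinearExt (f i) q := by
  simp only [multilinearExt, Finset.mul_sum]
  exact Finset.sum_comm

theorem multilinearExt_eq_sum_powerset_erase (f : Finset E → ℝ) (q : E → ℝ) (e : E) :
    multilinearExt f q = ∑ Q ∈ (Finset.univ.erase e).powerset,
      (∏ j ∈ Finset.univ.erase e, if j ∈ Q then q j else 1 - q j) *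
        (q e * f (insert e Q) + (1 - q e) * f (Q.erase e)) := by
  have hu : (Finset.univ : Finset (Finset E)) = (insert e (Finset.univ.erase e)).powerset := by
    simp
  rw [multilinearExt, hu, Finset.sum_powerset_insert (Finset.notMem_erase e _),
    ← Finset.sum_add_distrib]
  refine Finset.sum_congr rfl fun Q hQ => ?_
  have heQ : e ∉ Q := fun h => Finset.notMem_erase e _ (Finset.mem_powerset.1 hQ h)
  have hp : ∀ s : Finset E, (∏ j, if j ∈ s then q j else 1 - q j) =
      (if e ∈ s then q e else 1 - q e) *
        ∏ j ∈ Finset.univ.erase e, if j ∈ s then q j else 1 - q j := fun s =>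
    (Finset.mul_prod_erase _ _ (Finset.mem_univ e)).symm
  have hc : (∏ j ∈ Finset.univ.erase e, if j ∈ insert e Q then q j else 1 - q j) =
      ∏ j ∈ Finset.univ.erase e, if j ∈ Q then q j else 1 - q j := by
    refine Finset.prod_congr rfl fun j hj => ?_
    simp [Finset.ne_of_mem_erase hj]
  rw [hp, hp, hc]
  simp only [heQ, if_false, Finset.mem_insert_self, if_true, Finset.erase_eq_of_notMem heQ]
  ring

theorem multilinearExt_update (f : Finset E → ℝ) (q : E → ℝ) (e : E) (t : ℝ) :
    multilinearExt f (Function.update q e t) =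
      t * multilinearExt (fun Q => f (insert e Q)) q +
        (1 - t) * multilinearExt (fun Q => f (Q.erase e)) q := by
  simp only [multilinearExt_eq_sum_powerset_erase _ _ e, Finset.mul_sum]
  rw [← Finset.sum_add_distrib]
  refine Finset.sum_congr rfl fun Q hQ => ?_
  have heQ : e ∉ Q := fun h => Finset.notMem_erase e _ (Finset.mem_powerset.1 hQ h)
  have hc : (∏ j ∈ Finset.univ.erase e, if j ∈ Q then Function.update q e t j
      else 1 - Function.update q e t j) =
      ∏ j ∈ Finset.univ.erase e, if j ∈ Q then q j else 1 - q j := by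
    refine Finset.prod_congr rfl fun j hj => ?_
    simp [Finset.ne_of_mem_erase hj]
  rw [hc]
  simp only [Function.update_self, Finset.insert_idem, Finset.erase_insert_eq_erase,
    Finset.erase_eq_of_notMem heQ]
  ring

theorem multilinearExt_split (f : Finset E → ℝ) (q : E → ℝ) (e : E) :
    multilinearExt f q = q e * multilinearExt (fun Q => f (insert e Q)) q +
        (1 - q e) * multilinearExt (fun Q => f (Q.erase e)) q := by
  conv_lhs => rw [← Function.update_eq_self e q]
  exact multilinearExt_update f q e (q e)

theorem multilinearExt_update_of_eq {f : Finset E → ℝ} {e : E}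
    (h : ∀ Q, f (insert e Q) = f (Q.erase e)) (q : E → ℝ) (t : ℝ) :
    multilinearExt f (Function.update q e t) = multilinearExt f q := by
  rw [multilinearExt_update, multilinearExt_split f q e]
  simp only [h]
  ring

theorem multilinearExt_const (c : ℝ) (q : E → ℝ) :
    multilinearExt (fun _ => c) q = c := by
  have h := Finset.prod_add q (fun e => 1 - q e) Finset.univ
  simp only [add_sub_cancel, Finset.prod_const_one, Finset.powerset_univ] at h
  rw [multilinearExt, ← Finset.sum_mul]
  have : ∀ Q : Finset E, (∏ e, if e ∈ Q then q e else 1 - q e) =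
      (∏ e ∈ Q, q e) * ∏ e ∈ Finset.univ \ Q, (1 - q e) := fun Q => by
    rw [Finset.prod_ite]
    congr 1
    · exact Finset.prod_congr (by ext; simp) fun _ _ => rfl
    · exact Finset.prod_congr (by ext; simp) fun _ _ => rfl
  simp only [this]
  rw [← h, one_mul]

theorem multilinearExt_nonneg {f : Finset E → ℝ} {q : E → ℝ} (h0 : ∀ e, 0 ≤ q e)
    (h1 : ∀ e, q e ≤ 1) (h : ∀ Q, 0 ≤ f Q) : 0 ≤ multilinearExt f q := by
  simpa [multilinearExt_const] using multilinearExt_mono h0 h1 h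

theorem multilinearExt_mem (q : E → ℝ) (e : E) :
    multilinearExt (fun Q => if e ∈ Q then 1 else 0) q = q e := by
  rw [multilinearExt_split _ q e]
  simp [multilinearExt_const]

theorem multilinearExt_indicator (f : Finset E → ℝ) (S : Finset E) :
    multilinearExt f (fun e => if e ∈ S then 1 else 0) = f S := by
  rw [multilinearExt, Finset.sum_eq_single S]
  · rw [Finset.prod_eq_one, one_mul]
    intro e _
    split_ifs <;> simp
  · intro Q _ hQ
    obtain ⟨e, he⟩ : ∃ e, ¬ (e ∈ Q ↔ e ∈ S) := by
      by_contra! h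
      exact hQ (Finset.ext h)
    rw [Finset.prod_eq_zero (Finset.mem_univ e), zero_mul]
    by_cases h1 : e ∈ Q <;> by_cases h2 : e ∈ S <;> simp_all
  · simp

theorem hasDerivAt_multilinearExt (f : Finset E → ℝ) (q : E → ℝ) (t : ℝ) :
    HasDerivAt (fun t : ℝ => multilinearExt f (fun e => t * q e))
      (∑ e, q e * (multilinearExt (fun Q => f (insert e Q)) (fun e => t * q e) -
        multilinearExt (fun Q => f (Q.erase e)) (fun e => t * q e))) t := by
  have hw : ∀ Q : Finset E, HasDerivAt
      (fun t : ℝ => (∏ e, if e ∈ Q then t * q e else 1 - t * q e) * f Q)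
      ((∑ e, (∏ j ∈ Finset.univ.erase e, if j ∈ Q then t * q j else 1 - t * q j) •
        (if e ∈ Q then q e else - q e)) * f Q) t := fun Q => by
    refine HasDerivAt.mul_const ?_ _
    refine HasDerivAt.fun_finsetProd fun e _ => ?_
    split_ifs
    · simpa using (hasDerivAt_id t).mul_const (q e)
    · simpa using ((hasDerivAt_id t).mul_const (q e)).const_sub 1
  have h := HasDerivAt.fun_sum (u := Finset.univ) fun Q _ => hw Q
  refine h.congr_deriv ?_
  simp only [Finset.sum_mul]
  rw [Finset.sum_comm]
  refine Finset.sum_congr rfl fun e _ => ?_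
  have key : ∀ z : E → ℝ, multilinearExt (fun Q => f (insert e Q)) z -
      multilinearExt (fun Q => f (Q.erase e)) z =
      ∑ Q : Finset E, (∏ j ∈ Finset.univ.erase e, if j ∈ Q then z j else 1 - z j) *
        (if e ∈ Q then 1 else -1) * f Q := fun z => by
    have h1 := multilinearExt_update f z e 1
    have h0 := multilinearExt_update f z e 0
    have hd : multilinearExt (fun Q => f (insert e Q)) z -
      multilinearExt (fun Q => f (Q.erase e)) z = multilinearExt f (Function.update z e 1) -
        multilinearExt f (Function.update z e 0) := by rw [h1, h0]; ring
    rw [hd, multilinearExt, multilinearExt, ← Finset.sum_sub_distrib]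
    refine Finset.sum_congr rfl fun Q _ => ?_
    have hp : ∀ t : ℝ, (∏ j, if j ∈ Q then Function.update z e t j
        else 1 - Function.update z e t j) = (if e ∈ Q then t else 1 - t) *
        ∏ j ∈ Finset.univ.erase e, if j ∈ Q then z j else 1 - z j := fun t => by
      rw [← Finset.mul_prod_erase _ _ (Finset.mem_univ e), Function.update_self]
      congr 1
      refine Finset.prod_congr rfl fun j hj => ?_
      simp [Finset.ne_of_mem_erase hj]
    rw [hp, hp]
    split_ifs <;> ring
  rw [key, Finset.mul_sum]
  refine Finset.sum_congr rfl fun Q _ => ?_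
  simp only [smul_eq_mul]
  split_ifs <;> ring

/-- If every set `A` satisfies the marginal bound, then the multilinear extension at `q` is at least
`1 - 1/e` times the benchmark `V`. -/
theorem le_multilinearExt_of_marginals {f : Finset E → ℝ} {q : E → ℝ} {V : ℝ}
    (h0 : ∀ e, 0 ≤ q e) (h1 : ∀ e, q e ≤ 1) (hf : 0 ≤ f ∅)
    (hV : ∀ A, V ≤ f A + ∑ e, q e * (f (insert e A) - f (A.erase e))) :
    (1 - 1 / Real.exp 1) * V ≤ multilinearExt f q := by
  set g : ℝ → ℝ := fun t => multilinearExt f (fun e => t * q e) with hg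
  set g' : ℝ → ℝ := fun t => ∑ e, q e * (multilinearExt (fun Q => f (insert e Q))
    (fun e => t * q e) - multilinearExt (fun Q => f (Q.erase e)) (fun e => t * q e)) with hg'
  have hd : ∀ t, HasDerivAt g (g' t) t := fun t => hasDerivAt_multilinearExt f q t
  have hb : ∀ t ∈ Set.Icc (0 : ℝ) 1, V ≤ g t + g' t := fun t ht => by
    have hm := multilinearExt_mono (q := fun e => t * q e) (fun e => mul_nonneg ht.1 (h0 e))
      (fun e => mul_le_one₀ ht.2 (h0 e) (h1 e)) hV
    rw [multilinearExt_const, multilinearExt_add, multilinearExt_sum] at hm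
    simp only [multilinearExt_const_mul, multilinearExt_sub] at hm
    exact hm
  have hG : ∀ t, HasDerivAt (fun t => Real.exp t * (g t - V))
      (Real.exp t * (g t - V) + Real.exp t * g' t) t := fun t =>
    (Real.hasDerivAt_exp t).mul ((hd t).sub_const V)
  have hmono : MonotoneOn (fun t => Real.exp t * (g t - V)) (Set.Icc 0 1) := by
    refine monotoneOn_of_deriv_nonneg (convex_Icc 0 1)
      (fun t _ => (hG t).continuousAt.continuousWithinAt)
      (fun t _ => (hG t).differentiableAt.differentiableWithinAt) fun t ht => ?_
    rw [interior_Icc] at ht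
    rw [(hG t).deriv, ← mul_add]
    exact mul_nonneg (Real.exp_pos t).le (by linarith [hb t ⟨ht.1.le, ht.2.le⟩])
  have h := hmono (Set.left_mem_Icc.2 zero_le_one) (Set.right_mem_Icc.2 zero_le_one) zero_le_one
  have hg0 : g 0 = f ∅ := by
    simpa [hg] using multilinearExt_indicator f ∅
  have hg1 : g 1 = multilinearExt f q := by simp [hg]
  simp only [hg0, hg1, Real.exp_zero, one_mul] at h
  have he := Real.exp_pos 1
  have : (1 - 1 / Real.exp 1) * V = V + (- V) / Real.exp 1 := by field_simp; ring
  rw [this]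
  have : (-V) / Real.exp 1 ≤ multilinearExt f q - V := by
    rw [div_le_iff₀ he]
    linarith
  linarith

end MultilinearExtension

section Exchange

variable {E : Type*} [DecidableEq E]

theorem SetSystem.IsMatroid.exchange {M : SetSystem E} (hM : M.IsMatroid) {A B : Finset E}
    (hA : M.feasible A) (hB : M.feasible B) {e : E} (heB : e ∈ B) (heA : e ∉ A) :
    M.feasible (insert e A) ∨ ∃ a ∈ A, a ∉ B ∧ M.feasible (insert e (A.erase a)) ∧
      M.feasible (insert a (B.erase e)) := by
  obtain ⟨N, hE, hN⟩ := hM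
  have hsub : ∀ S : Set E, S ⊆ N.E := fun S => hE ▸ Set.subset_univ S
  rw [or_iff_not_imp_left]
  intro hdep
  rw [hN] at hdep hA hB
  rw [Finset.coe_insert] at hdep
  have hecl : e ∈ N.closure A := by
    by_contra h
    exact hdep (hA.insert_indep_iff.2 (Or.inl ⟨hsub _ (Set.mem_singleton e), h⟩))
  have heA' : e ∉ (A : Set E) := by simpa using heA
  have hC := hA.fundCircuit_isCircuit hecl heA'
  have heC := N.mem_fundCircuit e A
  have hBe : N.Indep ((B : Set E) \ {e}) := hB.sdiff _
  have hne : e ∉ N.closure ((B : Set E) \ {e}) :=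
    hB.notMem_closure_sdiff_of_mem (by simpa using heB)
  obtain ⟨a, haC, hacl⟩ : ∃ a ∈ N.fundCircuit e A \ {e}, a ∉ N.closure ((B : Set E) \ {e}) := by
    by_contra! h
    exact hne (N.closure_subset_closure_of_subset_closure h
      (hC.mem_closure_sdiff_singleton_of_mem heC))
  have hae : a ≠ e := fun h => haC.2 h
  have haA : a ∈ A := by
    have := N.fundCircuit_subset_insert e A haC.1
    simpa [hae] using this
  have haB : a ∉ B := fun h => hacl
    (N.subset_closure _ (hsub _) ⟨by simpa using h, by simpa using hae⟩)
  refine ⟨a, haA, haB, ?_, ?_⟩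
  · have := (hA.mem_fundCircuit_iff hecl heA').1 haC.1
    rw [hN]
    refine this.subset ?_
    intro x
    simp only [Finset.coe_insert, Finset.coe_erase, Set.mem_insert_iff, Set.mem_sdiff,
      Set.mem_singleton_iff]
    rintro (rfl | ⟨h1, h2⟩)
    · exact ⟨Or.inl rfl, hae.symm⟩
    · exact ⟨Or.inr h1, h2⟩
  · rw [hN, Finset.coe_insert, Finset.coe_erase]
    exact hBe.insert_indep_iff.2 (Or.inl ⟨hsub _ (Set.mem_singleton a), hacl⟩)

end Exchange

section MaxWeight

variable {E : Type*} [Fintype E]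

open Classical in
/-- The largest total weight of a feasible set. -/
noncomputable def maxWeight (M : SetSystem E) (w : E → ℝ≥0) : ℝ≥0 :=
  (Finset.univ.filter M.feasible).sup fun G => ∑ e ∈ G, w e

theorem sum_le_maxWeight {M : SetSystem E} {G : Finset E} (hG : M.feasible G) (w : E → ℝ≥0) :
    ∑ e ∈ G, w e ≤ maxWeight M w := by
  classical
  exact Finset.le_sup (f := fun G => ∑ e ∈ G, w e) (by simpa using hG)

theorem exists_maxWeight_eq (M : SetSystem E) (w : E → ℝ≥0) :
    ∃ G, M.feasible G ∧ maxWeight M w = ∑ e ∈ G, w e := by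
  classical
  obtain ⟨G, hG, h⟩ := Finset.exists_mem_eq_sup (Finset.univ.filter M.feasible)
    ⟨∅, by simpa using M.empty_feasible⟩ fun G => ∑ e ∈ G, w e
  exact ⟨G, by simpa using hG, h⟩

theorem maxWeight_mono (M : SetSystem E) {w w' : E → ℝ≥0} (h : ∀ e, w e ≤ w' e) :
    maxWeight M w ≤ maxWeight M w' := by
  obtain ⟨G, hG, hw⟩ := exists_maxWeight_eq M w
  rw [hw]
  exact (Finset.sum_le_sum fun e _ => h e).trans (sum_le_maxWeight hG w')

theorem continuous_maxWeight (M : SetSystem E) : Continuous (maxWeight M) := by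
  classical
  exact Continuous.finset_sup_apply fun G _ => continuous_finsetSum _ fun e _ => continuous_apply e

variable [DecidableEq E]

theorem maxWeight_update_add_le {M : SetSystem E} (hM : M.IsMatroid) {w w' : E → ℝ≥0} {e : E}
    (h : ∀ j, j ≠ e → w j ≤ w' j) (s : ℝ≥0) :
    maxWeight M (Function.update w e 0) + maxWeight M (Function.update w' e s) ≤
      maxWeight M (Function.update w e s) + maxWeight M (Function.update w' e 0) := by
  have hup : ∀ (v : E → ℝ≥0) (t : ℝ≥0) (G : Finset E), e ∉ G →
      ∑ j ∈ G, Function.update v e t j = ∑ j ∈ G, v j := fun v t G hG =>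
    Finset.sum_congr rfl fun j hj => Function.update_of_ne (by rintro rfl; exact hG hj) _ _
  obtain ⟨A, hA, hAw⟩ : ∃ A, M.feasible A ∧ e ∉ A ∧
      maxWeight M (Function.update w e 0) = ∑ j ∈ A, w j := by
    obtain ⟨A, hA, hAw⟩ := exists_maxWeight_eq M (Function.update w e 0)
    refine ⟨A.erase e, M.down_closed _ _ (A.erase_subset e) hA, A.notMem_erase e, ?_⟩
    rw [hAw, ← hup w 0 _ (A.notMem_erase e)]
    by_cases he : e ∈ A
    · rw [← Finset.add_sum_erase _ _ he, Function.update_self, zero_add]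
    · rw [Finset.erase_eq_of_notMem he]
  obtain ⟨heA, hAw⟩ := hAw
  obtain ⟨B, hB, hBw⟩ := exists_maxWeight_eq M (Function.update w' e s)
  rw [hAw, hBw]
  by_cases heB : e ∈ B
  · have hB' : ∑ j ∈ B, Function.update w' e s j = s + ∑ j ∈ B.erase e, w' j := by
      rw [← Finset.add_sum_erase _ _ heB, Function.update_self, hup _ _ _ (B.notMem_erase e)]
    rw [hB']
    rcases hM.exchange hA hB heB heA with h1 | ⟨a, haA, haB, h1, h2⟩
    · have i1 := sum_le_maxWeight h1 (Function.update w e s)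
      have i2 := sum_le_maxWeight (M.down_closed _ _ (B.erase_subset e) hB)
        (Function.update w' e 0)
      rw [hup _ _ _ (B.notMem_erase e)] at i2
      rw [Finset.sum_insert heA, Function.update_self, hup _ _ _ heA] at i1
      calc _ = (s + ∑ j ∈ A, w j) + ∑ j ∈ B.erase e, w' j := by ring
        _ ≤ _ := add_le_add i1 i2
    · have hea : e ≠ a := fun h => heA (h ▸ haA)
      have i1 := sum_le_maxWeight h1 (Function.update w e s)
      have i2 := sum_le_maxWeight h2 (Function.update w' e 0)
      have n1 : e ∉ A.erase a := fun h => heA (Finset.mem_of_mem_erase h)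
      have n2 : e ∉ insert a (B.erase e) := by simp [hea]
      rw [hup _ _ _ n2, Finset.sum_insert (by simp [haB])] at i2
      rw [Finset.sum_insert n1, Function.update_self, hup _ _ _ n1] at i1
      rw [← Finset.add_sum_erase _ _ haA]
      have i3 := h a hea.symm
      calc _ = w a + ((s + ∑ j ∈ A.erase a, w j) + ∑ j ∈ B.erase e, w' j) := by ring
        _ ≤ w' a + ((s + ∑ j ∈ A.erase a, w j) + ∑ j ∈ B.erase e, w' j) := by gcongr
        _ = (s + ∑ j ∈ A.erase a, w j) + (w' a + ∑ j ∈ B.erase e, w' j) := by ring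
        _ ≤ _ := add_le_add i1 i2
  · have i1 := sum_le_maxWeight hA (Function.update w e s)
    have i2 := sum_le_maxWeight hB (Function.update w' e 0)
    rw [hup _ _ _ heA] at i1
    rw [hup _ _ _ heB] at i2
    rw [hup _ _ _ heB]
    exact add_le_add i1 i2

theorem maxWeight_sup_add_sum_le {M : SetSystem E} (hM : M.IsMatroid) (w v : E → ℝ≥0)
    (F : Finset E) :
    maxWeight M (fun j => if j ∈ F then max (w j) (v j) else w j) +
        ∑ e ∈ F, maxWeight M (Function.update w e 0) ≤
      maxWeight M w + ∑ e ∈ F, maxWeight M (Function.update w e (v e)) := by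
  induction F using Finset.induction_on with
  | empty => simp
  | insert e F he ih =>
    rw [Finset.sum_insert he, Finset.sum_insert he]
    set wF : E → ℝ≥0 := fun j => if j ∈ F then max (w j) (v j) else w j with hwF
    have hle : ∀ j, w j ≤ wF j := fun j => by
      simp only [hwF]; split_ifs <;> simp
    have hwe : wF e = w e := by simp [hwF, he]
    have hins : (fun j => if j ∈ insert e F then max (w j) (v j) else w j) =
        Function.update wF e (max (w e) (v e)) := by
      funext j
      by_cases hj : j = e
      · subst hj; simp
      · simp [hwF, hj]
    rw [hins]
    have step : maxWeight M (Function.update wF e (max (w e) (v e))) +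
        maxWeight M (Function.update w e 0) ≤
        maxWeight M wF + maxWeight M (Function.update w e (v e)) := by
      rcases le_total (v e) (w e) with hv | hv
      · rw [max_eq_left hv, ← hwe, Function.update_eq_self]
        refine add_le_add le_rfl (maxWeight_mono M fun j => ?_)
        by_cases hj : j = e
        · subst hj; simp
        · simp [hj]
      · rw [max_eq_right hv, add_comm, add_comm (maxWeight M wF)]
        refine (maxWeight_update_add_le hM (fun j _ => hle j) (v e)).trans
          (add_le_add le_rfl (maxWeight_mono M fun j => ?_))
        by_cases hj : j = e
        · subst hj; simp
        · simp [hj]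
    calc _ = (maxWeight M (Function.update wF e (max (w e) (v e))) +
        maxWeight M (Function.update w e 0)) + ∑ e ∈ F, maxWeight M (Function.update w e 0) := by
          ring
      _ ≤ (maxWeight M wF + maxWeight M (Function.update w e (v e))) +
          ∑ e ∈ F, maxWeight M (Function.update w e 0) := by gcongr
      _ = (maxWeight M wF + ∑ e ∈ F, maxWeight M (Function.update w e 0)) +
          maxWeight M (Function.update w e (v e)) := by ring
      _ ≤ (maxWeight M w + ∑ e ∈ F, maxWeight M (Function.update w e (v e))) +
          maxWeight M (Function.update w e (v e)) := by gcongr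
      _ = _ := by ring

/-- The weighted rank function of `M`: the largest weight of a feasible subset of `F`. -/
noncomputable def weightedRank (M : SetSystem E) (w : E → ℝ≥0) (F : Finset E) : ℝ≥0 :=
  maxWeight M fun e => if e ∈ F then w e else 0

theorem weightedRank_mono (M : SetSystem E) (w : E → ℝ≥0) {F F' : Finset E} (h : F ⊆ F') :
    weightedRank M w F ≤ weightedRank M w F' := by
  refine maxWeight_mono M fun e => ?_
  by_cases he : e ∈ F
  · simp [he, h he]
  · simp [he]

theorem weightedRank_submodular {M : SetSystem E} (hM : M.IsMatroid) (w : E → ℝ≥0) {F : Finset E}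
    {i j : E} (hi : i ∉ F) (hij : i ≠ j) :
    weightedRank M w (insert i (insert j F)) + weightedRank M w F ≤
      weightedRank M w (insert i F) + weightedRank M w (insert j F) := by
  have h := maxWeight_update_add_le hM (e := i) (w := fun e => if e ∈ F then w e else 0)
    (w' := fun e => if e ∈ insert j F then w e else 0) (fun k _ => by
      by_cases hk : k ∈ F
      · simp [hk]
      · simp [hk]) (w i)
  have e1 : Function.update (fun e => if e ∈ F then w e else 0) i 0 =
      fun e => if e ∈ F then w e else 0 := by
    rw [Function.update_eq_self_iff]; simp [hi]
  have e2 : Function.update (fun e => if e ∈ insert j F then w e else 0) i 0 =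
      fun e => if e ∈ insert j F then w e else 0 := by
    rw [Function.update_eq_self_iff]; simp [hi, hij]
  have e3 : ∀ G : Finset E, Function.update (fun e => if e ∈ G then w e else 0) i (w i) =
      fun e => if e ∈ insert i G then w e else 0 := fun G => by
    funext k
    by_cases hk : k = i
    · subst hk; simp
    · simp [hk]
  rw [e1, e2, e3, e3] at h
  rw [add_comm]
  exact h

theorem weightedRank_add_sum_le {M : SetSystem E} (hM : M.IsMatroid) (v w : E → ℝ≥0)
    (F A : Finset E) :
    weightedRank M v F + ∑ e ∈ F, weightedRank M w (A.erase e) ≤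
      weightedRank M w A +
        ∑ e ∈ F, weightedRank M (Function.update w e (v e)) (insert e A) := by
  have h := maxWeight_sup_add_sum_le hM (fun e => if e ∈ A then w e else 0) v F
  refine le_trans (add_le_add (maxWeight_mono M fun e => ?_) (Finset.sum_le_sum fun e _ => ?_))
    (h.trans (add_le_add le_rfl (Finset.sum_le_sum fun e _ => ?_)))
  · by_cases he : e ∈ F <;> simp [he]
  · refine (le_of_eq ?_)
    unfold weightedRank
    congr 1
    funext k
    by_cases hk : k = e
    · subst hk; simp
    · simp [hk]
  · refine (le_of_eq ?_)
    unfold weightedRank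
    congr 1
    funext k
    by_cases hk : k = e
    · subst hk; simp
    · simp [hk]

theorem exists_weightedRank_eq (M : SetSystem E) (w : E → ℝ≥0) (F : Finset E) :
    ∃ G ⊆ F, M.feasible G ∧ weightedRank M w F = ∑ e ∈ G, w e := by
  obtain ⟨G, hG, h⟩ := exists_maxWeight_eq M fun e => if e ∈ F then w e else 0
  refine ⟨G ∩ F, Finset.inter_subset_right,
    M.down_closed _ _ Finset.inter_subset_left hG, ?_⟩
  rw [weightedRank, h, ← Finset.sum_filter, Finset.filter_mem_eq_inter]

theorem sum_le_weightedRank {M : SetSystem E} {w : E → ℝ≥0} {F G : Finset E} (hGF : G ⊆ F)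
    (hG : M.feasible G) : ∑ e ∈ G, w e ≤ weightedRank M w F := by
  refine le_trans (le_of_eq (Finset.sum_congr rfl fun e he => ?_)) (sum_le_maxWeight hG _)
  rw [if_pos (hGF he)]

end MaxWeight

section Rounding

variable {E : Type*} [Fintype E] [DecidableEq E]

theorem multilinearExt_le_update {f : Finset E → ℝ} {z : E → ℝ} (h0 : ∀ e, 0 ≤ z e)
    (h1 : ∀ e, z e ≤ 1) (hf : ∀ A B, A ⊆ B → f A ≤ f B) (e : E) {t : ℝ} (ht : z e ≤ t) :
    multilinearExt f z ≤ multilinearExt f (Function.update z e t) := by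
  rw [multilinearExt_update, multilinearExt_split f z e]
  have := multilinearExt_mono h0 h1 (fun Q => hf (Q.erase e) (insert e Q)
    ((Q.erase_subset e).trans (Q.subset_insert e)))
  nlinarith

theorem multilinearExt_le_swap {f : Finset E → ℝ} {z : E → ℝ} (h0 : ∀ e, 0 ≤ z e)
    (h1 : ∀ e, z e ≤ 1) (hf : ∀ A i j, i ∉ A → j ∉ A → i ≠ j →
      f (insert i (insert j A)) + f A ≤ f (insert i A) + f (insert j A)) {a e : E} (hae : a ≠ e)
    {α β : ℝ} (hα : 0 ≤ α) (hβ : 0 ≤ β) :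
    multilinearExt f z ≤
        multilinearExt f (Function.update (Function.update z e (z e + α)) a (z a - α)) ∨
      multilinearExt f z ≤
        multilinearExt f (Function.update (Function.update z e (z e - β)) a (z a + β)) := by
  set F11 := multilinearExt (fun Q => f (insert a (insert e Q))) z with h11
  set F01 := multilinearExt (fun Q => f (insert a (Q.erase e))) z with h01
  set F10 := multilinearExt (fun Q => f ((insert e Q).erase a)) z with h10
  set F00 := multilinearExt (fun Q => f ((Q.erase e).erase a)) z with h00
  have key : ∀ x y, multilinearExt f (Function.update (Function.update z e x) a y) =
      y * (x * F11 + (1 - x) * F01) + (1 - y) * (x * F10 + (1 - x) * F00) := fun x y => by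
    rw [multilinearExt_update, multilinearExt_update, multilinearExt_update]
  have hz : multilinearExt f z =
      z a * (z e * F11 + (1 - z e) * F01) + (1 - z a) * (z e * F10 + (1 - z e) * F00) := by
    rw [← key, Function.update_eq_self, Function.update_eq_self]
  have hc : F11 + F00 ≤ F10 + F01 := by
    rw [h11, h00, h10, h01, ← multilinearExt_add, ← multilinearExt_add]
    refine multilinearExt_mono h0 h1 fun Q => ?_
    have := hf ((Q.erase e).erase a) a e (by simp) (by simp) hae
    have e1 : insert e ((Q.erase e).erase a) = (insert e Q).erase a := by
      ext k; simp only [Finset.mem_insert, Finset.mem_erase]; grind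
    have e2 : insert a ((Q.erase e).erase a) = insert a (Q.erase e) := by
      ext k; simp only [Finset.mem_insert, Finset.mem_erase]; grind
    have e3 : insert a ((insert e Q).erase a) = insert a (insert e Q) := by
      ext k; simp only [Finset.mem_insert, Finset.mem_erase]; grind
    rw [e1, e2, e3] at this
    linarith
  rw [key, key, hz]
  by_contra! hcon
  obtain ⟨c1, c2⟩ := hcon
  set L := z a * (F11 - F01) + (1 - z a) * (F10 - F00) - z e * (F11 - F10) -
    (1 - z e) * (F01 - F00) with hL
  have d1 : α * L + α ^ 2 * (F10 + F01 - F11 - F00) < 0 := by rw [hL]; linarith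
  have d2 : -β * L + β ^ 2 * (F10 + F01 - F11 - F00) < 0 := by rw [hL]; linarith
  have p : 0 ≤ F10 + F01 - F11 - F00 := by linarith
  have d1' : α * L < 0 := by nlinarith [mul_nonneg (sq_nonneg α) p]
  have d2' : 0 < β * L := by nlinarith [mul_nonneg (sq_nonneg β) p]
  have : L < 0 := by
    by_contra! h
    linarith [mul_nonneg hα h]
  linarith [mul_nonneg hβ (neg_nonneg.2 this.le)]

theorem exists_merge {M : SetSystem E} (hM : M.IsMatroid) {f : Finset E → ℝ}
    (hmono : ∀ A B, A ⊆ B → f A ≤ f B) (hsub : ∀ A i j, i ∉ A → j ∉ A → i ≠ j →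
      f (insert i (insert j A)) + f A ≤ f (insert i A) + f (insert j A))
    {z : E → ℝ} {α β : ℝ} (hz : ∀ e, 0 ≤ z e) (hα : 0 ≤ α) (hβ : 0 ≤ β)
    (h1 : ∀ e, z e + α + β ≤ 1) (n : ℕ) : ∀ A B : Finset E, M.feasible A → M.feasible B →
      (A \ B).card + (B \ A).card = n → ∃ C, M.feasible C ∧
      multilinearExt f (fun j => z j + α * (if j ∈ A then 1 else 0) +
        β * (if j ∈ B then 1 else 0)) ≤
      multilinearExt f (fun j => z j + (α + β) * (if j ∈ C then 1 else 0)) := by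
  induction n using Nat.strong_induction_on with
  | _ n ih =>
  intro A B hA hB hn
  have p0 : ∀ j, 0 ≤ z j + α * (if j ∈ A then 1 else 0) + β * (if j ∈ B then 1 else 0) := by
    intro j
    have := hz j
    split_ifs <;> linarith
  have p1 : ∀ j, z j + α * (if j ∈ A then 1 else 0) + β * (if j ∈ B then 1 else 0) ≤ 1 := by
    intro j
    have := h1 j
    split_ifs <;> linarith
  by_cases hBA : B ⊆ A
  · by_cases hAB : A ⊆ B
    · obtain rfl := hAB.antisymm hBA
      refine ⟨A, hA, le_of_eq ?_⟩
      congr 1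
      funext j
      ring
    · obtain ⟨e, heA, heB⟩ := Finset.not_subset.1 hAB
      have hlt : (A \ insert e B).card + (insert e B \ A).card < n := by
        have c1 : insert e B \ A = B \ A := Finset.insert_sdiff_of_mem _ heA
        have c2 : (A \ insert e B).card < (A \ B).card := by
          refine Finset.card_lt_card (Finset.ssubset_iff_of_subset ?_ |>.2 ⟨e, ?_, ?_⟩)
          · exact Finset.sdiff_subset_sdiff le_rfl (B.subset_insert e)
          · simp [heA, heB]
          · simp
        rw [c1]; omega
      obtain ⟨C, hC, hle⟩ := ih _ hlt A (insert e B) hA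
        (M.down_closed _ _ (Finset.insert_subset heA hBA) hA) rfl
      refine ⟨C, hC, le_trans ?_ hle⟩
      refine (multilinearExt_le_update p0 p1 hmono e (t := z e + α + β) ?_).trans (le_of_eq ?_)
      · split_ifs; linarith
      · congr 1
        funext j
        by_cases hj : j = e
        · subst hj; simp [heA]
        · simp [hj]
  · obtain ⟨e, heB, heA⟩ := Finset.not_subset.1 hBA
    rcases hM.exchange hA hB heB heA with hf | ⟨a, haA, haB, hf1, hf2⟩
    · have hlt : (insert e A \ B).card + (B \ insert e A).card < n := by
        have c1 : insert e A \ B = A \ B := Finset.insert_sdiff_of_mem _ heB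
        have c2 : (B \ insert e A).card < (B \ A).card := by
          refine Finset.card_lt_card (Finset.ssubset_iff_of_subset ?_ |>.2 ⟨e, ?_, ?_⟩)
          · exact Finset.sdiff_subset_sdiff le_rfl (A.subset_insert e)
          · simp [heA, heB]
          · simp
        rw [c1]; omega
      obtain ⟨C, hC, hle⟩ := ih _ hlt (insert e A) B hf hB rfl
      refine ⟨C, hC, le_trans ?_ hle⟩
      refine (multilinearExt_le_update p0 p1 hmono e (t := z e + α + β) ?_).trans (le_of_eq ?_)
      · split_ifs; linarith
      · congr 1
        funext j
        by_cases hj : j = e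
        · subst hj; simp [heB]
        · simp [hj]
    · have hae : a ≠ e := fun h => heA (h ▸ haA)
      rcases multilinearExt_le_swap p0 p1 hsub hae hα hβ with hs | hs
      · have hlt : (insert e (A.erase a) \ B).card + (B \ insert e (A.erase a)).card < n := by
          have c1 : (insert e (A.erase a) \ B).card ≤ (A \ B).card := by
            refine Finset.card_le_card fun k => ?_
            simp only [Finset.mem_sdiff, Finset.mem_insert, Finset.mem_erase]
            grind
          have c2 : (B \ insert e (A.erase a)).card < (B \ A).card := by
            refine Finset.card_lt_card (Finset.ssubset_iff_of_subset (fun k => ?_) |>.2 ⟨e, ?_, ?_⟩)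
            · simp only [Finset.mem_sdiff, Finset.mem_insert, Finset.mem_erase]
              grind
            · simp [heA, heB]
            · simp
          omega
        obtain ⟨C, hC, hle⟩ := ih _ hlt (insert e (A.erase a)) B hf1 hB rfl
        refine ⟨C, hC, le_trans (hs.trans (le_of_eq ?_)) hle⟩
        congr 1
        funext j
        by_cases hj : j = a
        · subst hj; simp [haA, haB, hae]
        · by_cases hj' : j = e
          · subst hj'; simp [heA, heB, hj]; ring
          · simp [hj, hj']
      · have hlt : (A \ insert a (B.erase e)).card + (insert a (B.erase e) \ A).card < n := by
          have c1 : (insert a (B.erase e) \ A).card ≤ (B \ A).card := by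
            refine Finset.card_le_card fun k => ?_
            simp only [Finset.mem_sdiff, Finset.mem_insert, Finset.mem_erase]
            grind
          have c2 : (A \ insert a (B.erase e)).card < (A \ B).card := by
            refine Finset.card_lt_card (Finset.ssubset_iff_of_subset (fun k => ?_) |>.2 ⟨a, ?_, ?_⟩)
            · simp only [Finset.mem_sdiff, Finset.mem_insert, Finset.mem_erase]
              grind
            · simp [haA, haB]
            · simp
          omega
        obtain ⟨C, hC, hle⟩ := ih _ hlt A (insert a (B.erase e)) hA hf2 rfl
        refine ⟨C, hC, le_trans (hs.trans (le_of_eq ?_)) hle⟩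
        congr 1
        funext j
        by_cases hj : j = a
        · subst hj; simp [haA, haB]
        · by_cases hj' : j = e
          · subst hj'; simp [heA, heB, hj]
          · simp [hj, hj']

/-- Rounding of a convex combination of independent sets to an independent set, without loss for
the multilinear extension of a monotone submodular function. -/
theorem exists_feasible_multilinearExt_le {M : SetSystem E} (hM : M.IsMatroid) {f : Finset E → ℝ}
    (hmono : ∀ A B, A ⊆ B → f A ≤ f B) (hsub : ∀ A i j, i ∉ A → j ∉ A → i ≠ j →
      f (insert i (insert j A)) + f A ≤ f (insert i A) + f (insert j A))
    {c : Finset E → ℝ} (hc : ∀ A, 0 ≤ c A) (hcM : ∀ A, ¬ M.feasible A → c A = 0)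
    (hc1 : ∑ A, c A = 1) :
    ∃ S, M.feasible S ∧
      multilinearExt f (fun e => ∑ A, c A * (if e ∈ A then 1 else 0)) ≤ f S := by
  have hstep : ∀ (s : Finset (Finset E)) (C : Finset E) (γ : ℝ), M.feasible C → 0 ≤ γ →
      γ + ∑ A ∈ s, c A ≤ 1 → ∃ S, M.feasible S ∧
      multilinearExt f (fun e => ∑ A ∈ s, c A * (if e ∈ A then 1 else 0) +
        γ * (if e ∈ C then 1 else 0)) ≤
      multilinearExt f (fun e => (γ + ∑ A ∈ s, c A) * (if e ∈ S then 1 else 0)) := by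
    intro s
    induction s using Finset.induction_on with
    | empty => exact fun C γ hC _ _ => ⟨C, hC, by simp⟩
    | insert B s hB ih =>
      intro C γ hC hγ h1
      rw [Finset.sum_insert hB] at h1
      by_cases hBM : M.feasible B
      · have hnn : ∀ e, 0 ≤ ∑ A ∈ s, c A * (if e ∈ A then (1 : ℝ) else 0) := fun e =>
          Finset.sum_nonneg fun A _ => mul_nonneg (hc A) (by split_ifs <;> simp)
        have hle : ∀ e, ∑ A ∈ s, c A * (if e ∈ A then (1 : ℝ) else 0) ≤ ∑ A ∈ s, c A := fun e =>
          Finset.sum_le_sum fun A _ => mul_le_of_le_one_right (hc A) (by split_ifs <;> simp)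
        obtain ⟨D, hD, hDle⟩ := exists_merge hM hmono hsub hnn (hc B) hγ
          (fun e => by linarith [hle e]) _ B C hBM hC rfl
        obtain ⟨S, hS, hSle⟩ := ih D (c B + γ) hD (add_nonneg (hc B) hγ) (by linarith)
        refine ⟨S, hS, le_trans (le_of_eq ?_) (hDle.trans (hSle.trans (le_of_eq ?_)))⟩
        · congr 1
          funext e
          rw [Finset.sum_insert hB]
          ring
        · rw [Finset.sum_insert hB]
          congr 1
          funext e
          ring
      · have h0 := hcM B hBM
        rw [h0, zero_add] at h1
        obtain ⟨S, hS, hSle⟩ := ih C γ hC hγ h1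
        refine ⟨S, hS, ?_⟩
        simpa only [Finset.sum_insert hB, h0, zero_mul, zero_add] using hSle
  obtain ⟨S, hS, hle⟩ := hstep Finset.univ ∅ 0 M.empty_feasible le_rfl (by rw [hc1, zero_add])
  refine ⟨S, hS, ?_⟩
  simpa only [hc1, zero_add, zero_mul, add_zero, one_mul, multilinearExt_indicator] using hle

end Rounding

section ContentionResolution

variable {E : Type*}

/-- The rank of a set in a matroid, as a real number. -/
noncomputable def realRank (N : Matroid E) (X : Set E) : ℝ := (N.eRk X).toNat

theorem realRank_congr_closure {N : Matroid E} {X Y : Set E} (h : N.closure X = N.closure Y) :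
    realRank N X = realRank N Y := by
  rw [realRank, realRank, ← N.eRk_closure_eq X, h, N.eRk_closure_eq]

theorem realRank_nonneg (N : Matroid E) (X : Set E) : 0 ≤ realRank N X := Nat.cast_nonneg _

theorem realRank_le_card (N : Matroid E) (A : Finset E) : realRank N A ≤ A.card := by
  have h := N.eRk_le_encard A
  rw [Set.encard_coe_eq_coe_finsetCard] at h
  unfold realRank
  exact_mod_cast ENat.toNat_le_of_le_natCast h

variable [Fintype E]

theorem eRk_ne_top (N : Matroid E) (X : Set E) : N.eRk X ≠ ⊤ :=
  ne_top_of_le_ne_top (Set.toFinite X).encard_lt_top.ne (N.eRk_le_encard X)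

theorem card_le_realRank {N : Matroid E} {I : Finset E} (hI : N.Indep I) {X : Set E}
    (hIX : (I : Set E) ⊆ X) : (I.card : ℝ) ≤ realRank N X := by
  have h := hI.encard_le_eRk_of_subset hIX
  rw [Set.encard_coe_eq_coe_finsetCard, ← ENat.natCast_toNat (eRk_ne_top N X)] at h
  unfold realRank
  exact_mod_cast h

theorem realRank_insert {N : Matroid E} (hE : N.E = Set.univ) {e : E} {X : Set E}
    (he : e ∉ N.closure X) : realRank N (insert e X) = realRank N X + 1 := by
  obtain ⟨I, hI⟩ := N.exists_isBasis X (hE ▸ Set.subset_univ X)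
  have heE : e ∈ N.E := hE ▸ Set.mem_univ e
  have hI' := hI.insert_isBasis_insert_of_notMem_closure (e := e) (by rwa [hI.closure_eq_closure])
  have heI : e ∉ I := fun h => he (N.subset_closure X (hE ▸ Set.subset_univ X) (hI.subset h))
  rw [realRank, realRank, hI'.eRk_eq_encard, hI.eRk_eq_encard, Set.encard_insert_of_notMem heI,
    ENat.toNat_add (Set.toFinite I).encard_lt_top.ne (by simp)]
  simp

variable [DecidableEq E]

/-- The element `e` is blocked for the family `FF` if some member of `FF` that consists of other
elements of `Q` cannot be extended by `e`. -/
def IsBlocked (FF : Set (Finset E)) (e : E) (Q : Finset E) : Prop :=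
  ∃ I ∈ FF, I ⊆ Q.erase e ∧ insert e I ∉ FF

open Classical in
theorem exists_proper_flat {N : Matroid E} (hE : N.E = Set.univ) {a : E → ℝ}
    (h0 : ∀ e, 0 ≤ a e) (h1 : ∀ e, a e ≤ 1) {b : ℝ} (hb1 : b ≤ 1) {G : Finset E}
    (hG : G.Nonempty) (hloop : ∀ e ∈ G, N.Indep {e}) (ha : ∑ e ∈ G, a e ≤ b * realRank N G) :
    ∃ S ⊂ G, ∀ e ∈ G, e ∉ S →
      multilinearExt (fun Q => if e ∈ N.closure ((Q ∩ G ∪ S : Finset E) : Set E) then 1 else 0) a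
        ≤ b := by
  have hsub : ∀ X : Set E, X ⊆ N.E := fun X => hE ▸ Set.subset_univ X
  set φ : Finset E → ℝ := fun S =>
    multilinearExt (fun Q => realRank N ((Q ∩ G ∪ S : Finset E) : Set E)) a -
      (1 - b) * realRank N S with hφ
  have hφcl : ∀ S T : Finset E, N.closure (S : Set E) = N.closure T → φ S = φ T := by
    intro S T h
    have : ∀ Q : Finset E, realRank N ((Q ∩ G ∪ S : Finset E) : Set E) =
        realRank N ((Q ∩ G ∪ T : Finset E) : Set E) := fun Q => by
      apply realRank_congr_closure
      rw [Finset.coe_union, Finset.coe_union, ← N.closure_union_closure_right_eq, h,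
        N.closure_union_closure_right_eq]
    simp only [hφ, this, realRank_congr_closure h]
  have hempty : φ ∅ ≤ φ G := by
    have e1 : φ G = b * realRank N G := by
      have : ∀ Q : Finset E, Q ∩ G ∪ G = G := fun Q =>
        Finset.union_eq_right.2 Finset.inter_subset_right
      simp only [hφ, this, multilinearExt_const]
      ring
    have e2 : φ ∅ ≤ ∑ e ∈ G, a e := by
      have hle : multilinearExt (fun Q => realRank N ((Q ∩ G ∪ ∅ : Finset E) : Set E)) a ≤
          multilinearExt (fun Q => ∑ e ∈ G, if e ∈ Q then 1 else 0) a := by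
        refine multilinearExt_mono h0 h1 fun Q => ?_
        refine (realRank_le_card N _).trans (le_of_eq ?_)
        rw [Finset.union_empty, ← Finset.sum_filter, Finset.sum_const, nsmul_eq_mul, mul_one,
          Finset.filter_mem_eq_inter, Finset.inter_comm]
      rw [multilinearExt_sum] at hle
      simp only [multilinearExt_mem] at hle
      have := mul_nonneg (sub_nonneg.2 hb1) (realRank_nonneg N ((∅ : Finset E) : Set E))
      simp only [hφ]
      linarith
    linarith
  set C : Finset (Finset E) := G.ssubsets.filter fun S => ∀ e ∈ G, e ∈ N.closure (S : Set E) → e ∈ S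
    with hC
  have hCmem : ∅ ∈ C := by
    simp only [hC, Finset.mem_filter, Finset.mem_ssubsets]
    refine ⟨Finset.empty_ssubset.2 hG, fun e he hcl => ?_⟩
    have := hloop e he
    rw [Matroid.indep_singleton] at this
    rw [Finset.coe_empty] at hcl
    exact absurd hcl this.not_isLoop
  obtain ⟨S, hSC, hmin⟩ := Finset.exists_min_image C φ ⟨∅, hCmem⟩
  simp only [hC, Finset.mem_filter, Finset.mem_ssubsets] at hSC
  refine ⟨S, hSC.1, fun e heG heS => ?_⟩
  have hecl : e ∉ N.closure (S : Set E) := fun h => heS (hSC.2 e heG h)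
  set T : Finset E := G.filter fun j => j ∈ N.closure ((insert e S : Finset E) : Set E) with hT
  have hTcl : N.closure (T : Set E) = N.closure ((insert e S : Finset E) : Set E) := by
    refine (N.closure_subset_closure_of_subset_closure ?_).antisymm (N.closure_subset_closure ?_)
    · intro j hj
      simp only [hT, Finset.coe_filter, Set.mem_ofPred_eq] at hj
      exact hj.2
    · intro j hj
      have hjG : j ∈ G := Finset.insert_subset heG hSC.1.1 hj
      simp only [hT, Finset.coe_filter, Set.mem_ofPred_eq]
      exact ⟨hjG, N.subset_closure _ (hsub _) hj⟩
  have hST : φ S ≤ φ T := by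
    by_cases hTG : T = G
    · rw [hTG]
      exact (hmin ∅ hCmem).trans hempty
    · refine hmin T ?_
      simp only [hC, Finset.mem_filter, Finset.mem_ssubsets]
      refine ⟨(Finset.filter_subset _ _).ssubset_of_ne hTG, fun j hj hjcl => ?_⟩
      rw [hTcl] at hjcl
      exact Finset.mem_filter.2 ⟨hj, hjcl⟩
  rw [hφcl T _ hTcl] at hST
  have hr : realRank N ((insert e S : Finset E) : Set E) = realRank N S + 1 := by
    rw [Finset.coe_insert, realRank_insert hE hecl]
  have hQ : ∀ Q : Finset E, realRank N ((Q ∩ G ∪ insert e S : Finset E) : Set E) =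
      realRank N ((Q ∩ G ∪ S : Finset E) : Set E) + (1 -
        (if e ∈ N.closure ((Q ∩ G ∪ S : Finset E) : Set E) then 1 else 0)) := fun Q => by
    rw [Finset.union_insert, Finset.coe_insert]
    split_ifs with h
    · rw [sub_self, add_zero]
      exact realRank_congr_closure (N.closure_insert_eq_of_mem_closure h)
    · rw [realRank_insert hE h, sub_zero]
  simp only [hφ, hQ, hr, multilinearExt_add, multilinearExt_sub, multilinearExt_const] at hST
  linarith

open Classical in
/-- Greedy contention resolution for matroids. -/
theorem exists_contention_resolution {N : Matroid E} (hE : N.E = Set.univ) {a : E → ℝ}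
    (h0 : ∀ e, 0 ≤ a e) (h1 : ∀ e, a e ≤ 1) {b : ℝ} (hb1 : b ≤ 1) (G : Finset E) :
    (∀ e ∈ G, N.Indep {e}) → (∀ A ⊆ G, ∑ e ∈ A, a e ≤ b * realRank N A) →
    ∃ FF : Set (Finset E), ∅ ∈ FF ∧ (∀ I ∈ FF, I ⊆ G ∧ N.Indep I) ∧
      ∀ e ∈ G, multilinearExt (fun Q => if IsBlocked FF e Q then 1 else 0) a ≤ b := by
  induction G using Finset.strongInduction with
  | H G ih =>
  intro hloop ha
  have hsub : ∀ X : Set E, X ⊆ N.E := fun X => hE ▸ Set.subset_univ X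
  rcases G.eq_empty_or_nonempty with rfl | hG
  · exact ⟨{∅}, rfl, by rintro I rfl; simp, by simp⟩
  obtain ⟨S, hSG, hS⟩ := exists_proper_flat hE h0 h1 hb1 hG hloop (ha G subset_rfl)
  obtain ⟨FS, hFS0, hFSi, hFSb⟩ := ih S hSG (fun e he => hloop e (hSG.1 he))
    fun A hA => ha A (hA.trans hSG.1)
  refine ⟨{I | I ∩ S ∈ FS ∧ I ⊆ G ∧ ∀ J ⊆ S, N.Indep J → N.Indep ((I \ S ∪ J : Finset E) : Set E)},
    ⟨by simpa using hFS0, by simp, fun J _ hJ => by simpa using hJ⟩, ?_, ?_⟩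
  · rintro I ⟨h1, h2, h3⟩
    refine ⟨h2, ?_⟩
    have := h3 (I ∩ S) Finset.inter_subset_right (hFSi _ h1).2
    rwa [Finset.sdiff_union_inter] at this
  · intro e heG
    by_cases heS : e ∈ S
    · refine le_trans (multilinearExt_mono h0 h1 fun Q => ?_) (hFSb e heS)
      have himp : IsBlocked {I | I ∩ S ∈ FS ∧ I ⊆ G ∧
          ∀ J ⊆ S, N.Indep J → N.Indep ((I \ S ∪ J : Finset E) : Set E)} e Q →
          IsBlocked FS e Q := by
        rintro ⟨I, ⟨i1, i2, i3⟩, hIQ, hI⟩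
        refine ⟨I ∩ S, i1, Finset.inter_subset_left.trans hIQ, fun hcon => hI ⟨?_, ?_, ?_⟩⟩
        · rwa [Finset.insert_inter_of_mem heS]
        · exact Finset.insert_subset heG i2
        · rwa [Finset.insert_sdiff_of_mem _ heS]
      by_cases hb : IsBlocked FS e Q
      · rw [if_pos hb]
        split_ifs <;> norm_num
      · rw [if_neg hb, if_neg fun h => hb (himp h)]
    · refine le_trans (multilinearExt_mono h0 h1 fun Q => ?_) (hS e heG heS)
      have himp : IsBlocked {I | I ∩ S ∈ FS ∧ I ⊆ G ∧
          ∀ J ⊆ S, N.Indep J → N.Indep ((I \ S ∪ J : Finset E) : Set E)} e Q →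
          e ∈ N.closure ((Q ∩ G ∪ S : Finset E) : Set E) := by
        rintro ⟨I, ⟨i1, i2, i3⟩, hIQ, hI⟩
        by_contra hcl
        refine hI ⟨by rwa [Finset.insert_inter_of_notMem heS], Finset.insert_subset heG i2,
          fun J hJS hJ => ?_⟩
        rw [Finset.insert_sdiff_of_notMem _ heS, Finset.insert_union, Finset.coe_insert]
        refine (i3 J hJS hJ).insert_indep_iff.2 (Or.inl ⟨hsub _ (Set.mem_singleton e),
          fun h => hcl (N.closure_subset_closure (Finset.coe_subset.2 ?_) h)⟩)
        refine Finset.union_subset_union (fun j hj => ?_) hJS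
        have hjI := (Finset.mem_sdiff.1 hj).1
        exact Finset.mem_inter.2 ⟨Finset.mem_of_mem_erase (hIQ hjI), i2 hjI⟩
      by_cases hb : e ∈ N.closure ((Q ∩ G ∪ S : Finset E) : Set E)
      · rw [if_pos hb]
        split_ifs <;> norm_num
      · rw [if_neg hb, if_neg fun h => hb (himp h)]

end ContentionResolution

section FiniteValued

theorem eq_sum_indicator_fiber {Ω ι : Type*} [Fintype ι] (F : Ω → ι) (Φ : ι → Ω → ℝ≥0∞) :
    (fun ω => Φ (F ω) ω) = fun ω => ∑ i, {ω | F ω = i}.indicator (Φ i) ω := by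
  classical
  funext ω
  rw [Finset.sum_eq_single (F ω)]
  · simp
  · intro i _ hi
    exact Set.indicator_of_notMem (fun h => hi h.symm) _
  · simp

variable {Ω ι : Type*} [MeasurableSpace Ω]

theorem exists_measurable_argmax {L : Type*} [LinearOrder L] (score : Ω → ι → L) {C : Finset ι}
    (hC : C.Nonempty) (h : ∀ i ∈ C, ∀ j ∈ C, MeasurableSet {ω | score ω i ≤ score ω j}) :
    ∃ g : Ω → ι, (∀ ω, g ω ∈ C ∧ ∀ i ∈ C, score ω i ≤ score ω (g ω)) ∧
      ∀ i, MeasurableSet {ω | g ω = i} := by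
  classical
  induction hC using Finset.Nonempty.cons_induction with
  | singleton a => exact ⟨fun _ => a, fun ω => by simp, fun i => MeasurableSet.const _⟩
  | cons a s ha hs ih =>
    obtain ⟨g, hg, hgm⟩ := ih fun i hi j hj => h i (by simp [hi]) j (by simp [hj])
    have hM : MeasurableSet {ω | score ω a ≤ score ω (g ω)} := by
      have : {ω | score ω a ≤ score ω (g ω)} =
          ⋃ j ∈ s, {ω | g ω = j} ∩ {ω | score ω a ≤ score ω j} := by
        ext ω
        simp only [Set.mem_ofPred_eq, Set.mem_iUnion, Set.mem_inter_iff]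
        constructor
        · exact fun hω => ⟨g ω, (hg ω).1, rfl, hω⟩
        · rintro ⟨j, _, rfl, hω⟩
          exact hω
      rw [this]
      exact Finset.measurableSet_biUnion _ fun j hj =>
        (hgm j).inter (h a (by simp) j (by simp [hj]))
    refine ⟨fun ω => if score ω a ≤ score ω (g ω) then g ω else a, fun ω => ?_, fun i => ?_⟩
    · dsimp only
      split_ifs with hω
      · refine ⟨by simp [(hg ω).1], fun i hi => ?_⟩
        rcases Finset.mem_cons.1 hi with rfl | hi
        · exact hω
        · exact (hg ω).2 i hi
      · refine ⟨by simp, fun i hi => ?_⟩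
        rcases Finset.mem_cons.1 hi with rfl | hi
        · exact le_rfl
        · exact ((hg ω).2 i hi).trans (not_le.1 hω).le
    · have : {ω | (if score ω a ≤ score ω (g ω) then g ω else a) = i} =
          ({ω | score ω a ≤ score ω (g ω)} ∩ {ω | g ω = i}) ∪
            ({ω | score ω a ≤ score ω (g ω)}ᶜ ∩ {_ω | a = i}) := by
        ext ω
        by_cases hω : score ω a ≤ score ω (g ω) <;> simp [hω]
      rw [this]
      exact (hM.inter (hgm i)).union (hM.compl.inter (MeasurableSet.const _))

variable [Fintype ι]

theorem measurable_comp_fiber {F : Ω → ι} (hF : ∀ i, MeasurableSet {ω | F ω = i})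
    {Φ : ι → Ω → ℝ≥0∞} (hΦ : ∀ i, Measurable (Φ i)) : Measurable fun ω => Φ (F ω) ω := by
  rw [eq_sum_indicator_fiber F Φ]
  exact Finset.measurable_sum _ fun i _ => (hΦ i).indicator (hF i)

theorem lintegral_comp_fiber {F : Ω → ι} (hF : ∀ i, MeasurableSet {ω | F ω = i}) (μ : Measure Ω)
    (c : ι → ℝ≥0∞) : ∫⁻ ω, c (F ω) ∂μ = ∑ i, c i * μ {ω | F ω = i} := by
  rw [eq_sum_indicator_fiber F fun i _ => c i,
    lintegral_finsetSum _ fun i _ => measurable_const.indicator (hF i)]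
  exact Finset.sum_congr rfl fun i _ => lintegral_indicator_const (hF i) _

theorem measurableSet_of_fiber {F : Ω → ι} (hF : ∀ i, MeasurableSet {ω | F ω = i})
    (p : ι → Prop) : MeasurableSet {ω | p (F ω)} := by
  classical
  have : {ω | p (F ω)} = ⋃ i ∈ Finset.univ.filter p, {ω | F ω = i} := by
    ext ω; simp
  rw [this]
  exact Finset.measurableSet_biUnion _ fun i _ => hF i

theorem sum_measureReal_fiber {F : Ω → ι} (hF : ∀ i, MeasurableSet {ω | F ω = i})
    (μ : Measure Ω) [IsProbabilityMeasure μ] : ∑ i, μ.real {ω | F ω = i} = 1 := by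
  have h := lintegral_comp_fiber hF μ fun _ => 1
  simp only [one_mul, lintegral_const, measure_univ] at h
  simp only [Measure.real]
  rw [← ENNReal.toReal_sum fun _ _ => measure_ne_top _ _, ← h]
  simp

theorem measureReal_mem_eq_sum {E : Type*} [Fintype E] [DecidableEq E] {F : Ω → Finset E}
    (hF : ∀ i, MeasurableSet {ω | F ω = i}) (μ : Measure Ω) [IsProbabilityMeasure μ] (e : E) :
    μ.real {ω | e ∈ F ω} = ∑ A, μ.real {ω | F ω = A} * (if e ∈ A then 1 else 0) := by
  have h := lintegral_comp_fiber hF μ fun A => if e ∈ A then 1 else 0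
  have hi : (fun ω => if e ∈ F ω then (1 : ℝ≥0∞) else 0) = {ω | e ∈ F ω}.indicator 1 := by
    funext ω
    simp [Set.indicator]
  rw [hi, lintegral_indicator_one (measurableSet_of_fiber hF fun A => e ∈ A)] at h
  rw [Measure.real, h, ENNReal.toReal_sum]
  · refine Finset.sum_congr rfl fun A _ => ?_
    split_ifs <;> simp [Measure.real]
  · intro A _
    split_ifs <;> simp

end FiniteValued

section Resampling

open Classical in
/-- The elements whose realization lies in the prescribed set. -/
noncomputable def activeSet {E U : Type*} [Fintype E] (A : E → Set U) (ω : E → U) : Finset E :=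
  Finset.univ.filter fun e => ω e ∈ A e

theorem mem_activeSet {E U : Type*} [Fintype E] {A : E → Set U} {ω : E → U} {e : E} : e ∈ activeSet A ω ↔ ω e ∈ A e := by
  simp [activeSet]

theorem activeSet_eq_iff {E U : Type*} [Fintype E] [DecidableEq E] {A : E → Set U} {Q : Finset E} :
    {ω : E → U | activeSet A ω = Q} = Set.pi Set.univ fun e => if e ∈ Q then A e else (A e)ᶜ := by
  ext ω
  simp only [Set.mem_ofPred_eq, Set.mem_univ_pi, Finset.ext_iff, mem_activeSet]
  refine forall_congr' fun e => ?_
  split_ifs with h <;> simp [h]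

variable {E U : Type*} [Fintype E] [DecidableEq E] [MeasurableSpace U] (μ : E → Measure U)
  [∀ e, IsProbabilityMeasure (μ e)]

theorem measurePreserving_update_pi (e : E) :
    MeasurePreserving (fun p : (E → U) × U => Function.update p.1 e p.2)
      ((Measure.pi μ).prod (μ e)) (Measure.pi μ) := by
  have hm : Measurable fun p : (E → U) × U => Function.update p.1 e p.2 := by
    rw [measurable_pi_iff]
    intro j
    by_cases hj : j = e
    · subst hj; simpa using measurable_snd
    · simp only [Function.update_of_ne hj]
      exact (measurable_pi_apply j).comp measurable_fst
  refine ⟨hm, (Measure.pi_eq fun s hs => ?_).symm⟩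
  rw [Measure.map_apply hm (MeasurableSet.univ_pi hs)]
  have : (fun p : (E → U) × U => Function.update p.1 e p.2) ⁻¹' Set.pi Set.univ s =
      (Set.pi Set.univ (Function.update s e Set.univ)) ×ˢ s e := by
    ext ⟨ω, v⟩
    simp only [Set.mem_preimage, Set.mem_univ_pi, Set.mem_prod]
    constructor
    · intro h
      refine ⟨fun j => ?_, by simpa using h e⟩
      by_cases hj : j = e
      · subst hj; simp
      · simpa [hj] using h j
    · rintro ⟨h1, h2⟩ j
      by_cases hj : j = e
      · subst hj; simpa using h2
      · simpa [hj] using h1 j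
  rw [this, Measure.prod_prod, Measure.pi_pi, ← Finset.mul_prod_erase _ _ (Finset.mem_univ e),
    ← Finset.mul_prod_erase _ (fun i => μ i (s i)) (Finset.mem_univ e), Function.update_self,
    measure_univ, one_mul, mul_comm]
  congr 1
  refine Finset.prod_congr rfl fun j hj => ?_
  rw [Function.update_of_ne (Finset.ne_of_mem_erase hj)]

theorem lintegral_pi_update (e : E) {Φ : (E → U) → ℝ≥0∞} (hΦ : Measurable Φ) :
    ∫⁻ ω, Φ ω ∂(Measure.pi μ) = ∫⁻ ω, ∫⁻ v, Φ (Function.update ω e v) ∂(μ e) ∂(Measure.pi μ) := by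
  have hp := measurePreserving_update_pi μ e
  exact (hp.lintegral_comp hΦ).symm.trans (lintegral_prod (fun p => Φ (Function.update p.1 e p.2))
    (hΦ.comp hp.measurable).aemeasurable)

theorem lintegral_pi_update_swap (e : E) {Φ : (E → U) → ℝ≥0∞} (hΦ : Measurable Φ) :
    ∫⁻ ω, Φ ω ∂(Measure.pi μ) = ∫⁻ v, ∫⁻ ω, Φ (Function.update ω e v) ∂(Measure.pi μ) ∂(μ e) := by
  rw [lintegral_pi_update μ e hΦ]
  exact lintegral_lintegral_swap
    (hΦ.comp (measurePreserving_update_pi μ e).measurable).aemeasurable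

theorem measurableSet_activeSet_eq {A : E → Set U} (hA : ∀ e, MeasurableSet (A e)) (Q : Finset E) :
    MeasurableSet {ω : E → U | activeSet A ω = Q} := by
  rw [activeSet_eq_iff]
  refine MeasurableSet.univ_pi fun e => ?_
  split_ifs
  · exact hA e
  · exact (hA e).compl

theorem lintegral_activeSet {A : E → Set U} (hA : ∀ e, MeasurableSet (A e)) {f : Finset E → ℝ}
    (hf : ∀ Q, 0 ≤ f Q) :
    ∫⁻ ω, ENNReal.ofReal (f (activeSet A ω)) ∂(Measure.pi μ) =
      ENNReal.ofReal (multilinearExt f fun e => (μ e).real (A e)) := by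
  rw [lintegral_comp_fiber (measurableSet_activeSet_eq hA) (Measure.pi μ)
    fun Q => ENNReal.ofReal (f Q)]
  have hp : ∀ Q : Finset E, ∀ e, 0 ≤ if e ∈ Q then (μ e).real (A e) else 1 - (μ e).real (A e) :=
    fun Q e => by
      split_ifs
      · exact measureReal_nonneg
      · linarith [measureReal_le_one (μ := μ e) (s := A e)]
  rw [multilinearExt, ENNReal.ofReal_sum_of_nonneg fun Q _ =>
    mul_nonneg (Finset.prod_nonneg fun e _ => hp Q e) (hf Q)]
  refine Finset.sum_congr rfl fun Q _ => ?_
  rw [activeSet_eq_iff, Measure.pi_pi, mul_comm, ENNReal.ofReal_mul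
    (Finset.prod_nonneg fun e _ => hp Q e), ENNReal.ofReal_prod_of_nonneg fun e _ => hp Q e]
  congr 1
  refine Finset.prod_congr rfl fun e _ => ?_
  split_ifs
  · simp
  · rw [← probReal_compl_eq_one_sub (hA e)]
    simp

end Resampling

section Strategies

variable {E : Type*} [DecidableEq E]

theorem Strategy.mem_probed_update (σ : Strategy E) (e : E) (ω : E → Utilities) (v : Utilities) :
    e ∈ σ.probed (Function.update ω e v) ↔ e ∈ σ.probed ω := by
  induction σ with
  | propose G => simp [Strategy.probed]
  | probe j next ih =>
    by_cases hj : e = j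
    · subst hj; simp [Strategy.probed]
    · simp [Strategy.probed, Function.update_of_ne (Ne.symm hj), ih, hj]

theorem Strategy.feasible_probed_of_feasibleFrom {M : SetSystem E} (σ : Strategy E) :
    ∀ F : Finset E, M.feasible F → σ.FeasibleFrom M F → ∀ ω, M.feasible (F ∪ σ.probed ω) := by
  induction σ with
  | propose G => intro F hF _ ω; simpa [Strategy.probed] using hF
  | probe j next ih =>
    intro F _ hσ ω
    have := ih (ω j) (insert j F) hσ.2.1 (hσ.2.2 _) ω
    simpa [Strategy.probed, Finset.insert_union, Finset.union_insert] using this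

theorem Instance.IsStrategy.feasible_probed {I : Instance E} {σ : Strategy E}
    (h : I.IsStrategy σ) (ω : E → Utilities) : I.outer.feasible (σ.probed ω) := by
  simpa using σ.feasible_probed_of_feasibleFrom ∅ I.outer.empty_feasible h.1 ω

end Strategies

section AdaptivityGap

variable {E : Type*} [Fintype E] [DecidableEq E]

theorem weightedRank_le_sum (M : SetSystem E) (w : E → ℝ≥0) (F : Finset E) :
    weightedRank M w F ≤ ∑ e, w e := by
  obtain ⟨G, _, _, h⟩ := exists_weightedRank_eq M w F
  rw [h]
  exact Finset.sum_le_sum_of_subset (Finset.subset_univ G)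

theorem measurable_weightedRank (M : SetSystem E) {w : E → Utilities → ℝ≥0}
    (hw : ∀ e, Measurable (w e)) (F : Finset E) :
    Measurable fun ω : E → Utilities => weightedRank M (fun e => w e (ω e)) F := by
  refine (continuous_maxWeight M).measurable.comp (measurable_pi_iff.2 fun e => ?_)
  by_cases he : e ∈ F
  · simp only [he, if_true]
    exact (hw e).comp (measurable_pi_apply e)
  · simp [he]

instance (I : Instance E) : IsProbabilityMeasure I.prob := by
  unfold Instance.prob; infer_instance

/-- The expected weighted rank of a fixed set of elements. -/
noncomputable def expectedRank (I : Instance E) (w : E → Utilities → ℝ≥0) (F : Finset E) : ℝ≥0∞ :=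
  ∫⁻ ω, (weightedRank I.inner (fun e => w e (ω e)) F : ℝ≥0∞) ∂I.prob

theorem lintegral_apply_prob (I : Instance E) (e : E) {g : Utilities → ℝ≥0∞} (hg : Measurable g) :
    ∫⁻ ω, g (ω e) ∂I.prob = ∫⁻ v, g v ∂(I.law e : Measure Utilities) := by
  rw [Instance.prob, lintegral_pi_update _ e (Φ := fun ω => g (ω e))
    (hg.comp (measurable_pi_apply e))]
  simp

theorem lintegral_weightedRank_ne_top (I : Instance E) {w : E → Utilities → ℝ≥0}
    (hw : ∀ e, Measurable (w e))
    (hfin : ∀ e, ∫⁻ v, (w e v : ℝ≥0∞) ∂(I.law e : Measure Utilities) ≠ ∞)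
    (F : (E → Utilities) → Finset E) :
    ∫⁻ ω, (weightedRank I.inner (fun e => w e (ω e)) (F ω) : ℝ≥0∞) ∂I.prob ≠ ∞ := by
  refine ne_top_of_le_ne_top (b := ∑ e, ∫⁻ v, (w e v : ℝ≥0∞) ∂(I.law e : Measure Utilities)) ?_ ?_
  · exact ENNReal.sum_ne_top.2 fun e _ => hfin e
  · have : ∀ e, ∫⁻ v, (w e v : ℝ≥0∞) ∂(I.law e : Measure Utilities) =
        ∫⁻ ω, (w e (ω e) : ℝ≥0∞) ∂I.prob := fun e =>
      (lintegral_apply_prob I e (hw e).coe_nnreal_ennreal).symm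
    simp only [this]
    have hm : ∀ e, Measurable fun ω : E → Utilities => (w e (ω e) : ℝ≥0∞) := fun e =>
      ((hw e).comp (measurable_pi_apply e)).coe_nnreal_ennreal
    rw [← lintegral_finsetSum _ fun e _ => hm e]
    refine lintegral_mono fun ω => ?_
    refine (ENNReal.coe_le_coe.2
      (weightedRank_le_sum I.inner (fun e => w e (ω e)) (F ω))).trans (le_of_eq ?_)
    push_cast
    rfl

theorem adaptive_add_sum_le (I : Instance E) (hin : I.inner.IsMatroid)
    {w : E → Utilities → ℝ≥0} (hw : ∀ e, Measurable (w e)) {σ : Strategy E}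
    (hσ : σ.IsMeasurable) (A : Finset E) :
    ∫⁻ ω, (weightedRank I.inner (fun e => w e (ω e)) (σ.probed ω) : ℝ≥0∞) ∂I.prob +
        ∑ e, I.prob {ω | e ∈ σ.probed ω} * expectedRank I w (A.erase e) ≤
      expectedRank I w A + ∑ e, I.prob {ω | e ∈ σ.probed ω} * expectedRank I w (insert e A) := by
  set P : E → Set (E → Utilities) := fun e => {ω | e ∈ σ.probed ω} with hP
  have hPm : ∀ e, MeasurableSet (P e) := fun e => measurableSet_of_fiber hσ.1 (fun F => e ∈ F)
  set r : (E → Utilities) → Finset E → ℝ≥0∞ := fun ω F =>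
    (weightedRank I.inner (fun e => w e (ω e)) F : ℝ≥0∞) with hr
  have hrm : ∀ F, Measurable fun ω => r ω F := fun F =>
    (measurable_weightedRank I.inner hw F).coe_nnreal_ennreal
  have hpt : ∀ ω' ω, r ω (σ.probed ω) + ∑ e, (P e).indicator 1 ω * r ω' (A.erase e) ≤
      r ω' A + ∑ e, (P e).indicator 1 ω * r (Function.update ω' e (ω e)) (insert e A) := by
    intro ω' ω
    have h := weightedRank_add_sum_le hin (fun e => w e (ω e)) (fun e => w e (ω' e))
      (σ.probed ω) A
    have hup : ∀ e, Function.update (fun j => w j (ω' j)) e (w e (ω e)) =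
        fun j => w j (Function.update ω' e (ω e) j) := fun e => by
      funext j
      by_cases hj : j = e
      · subst hj; simp
      · simp [hj]
    simp only [hup] at h
    have hs : ∀ g : E → ℝ≥0∞, ∑ e, (P e).indicator 1 ω * g e = ∑ e ∈ σ.probed ω, g e := fun g => by
      rw [← Finset.sum_filter_add_sum_filter_not Finset.univ (fun e => e ∈ σ.probed ω)]
      rw [Finset.sum_eq_zero (s := Finset.univ.filter fun e => ¬ e ∈ σ.probed ω), add_zero]
      · refine Finset.sum_congr (by ext; simp) fun e he => ?_
        rw [Set.indicator_of_mem (by simpa [hP] using he)]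
        simp
      · intro e he
        rw [Set.indicator_of_notMem (by simpa [hP] using he), zero_mul]
    rw [hs, hs]
    simp only [hr]
    exact_mod_cast h
  have hint := lintegral_mono (μ := I.prob) fun ω' => lintegral_mono (μ := I.prob) (hpt ω')
  have hPi : ∀ e, ∫⁻ ω, (P e).indicator 1 ω ∂I.prob = I.prob (P e) := fun e =>
    lintegral_indicator_one (hPm e)
  have hPmeas : ∀ e, Measurable ((P e).indicator (1 : (E → Utilities) → ℝ≥0∞)) := fun e =>
    measurable_one.indicator (hPm e)
  have hPm' : ∀ (c : E → ℝ≥0∞) (e : E),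
      Measurable fun ω => (P e).indicator (1 : (E → Utilities) → ℝ≥0∞) ω * c e := fun c e =>
    (hPmeas e).mul_const _
  have hupm : ∀ (ω' : E → Utilities) (e : E), Measurable fun v => Function.update ω' e v :=
    fun ω' e => measurable_update ω'
  have hL : ∀ ω', ∫⁻ ω, (r ω (σ.probed ω) + ∑ e, (P e).indicator 1 ω * r ω' (A.erase e)) ∂I.prob =
      ∫⁻ ω, r ω (σ.probed ω) ∂I.prob + ∑ e, I.prob (P e) * r ω' (A.erase e) := fun ω' => by
    rw [lintegral_add_right _ (Finset.measurable_sum _ fun e _ =>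
        hPm' (fun e => r ω' (A.erase e)) e),
      lintegral_finsetSum _ fun e _ => hPm' (fun e => r ω' (A.erase e)) e]
    congr 1
    refine Finset.sum_congr rfl fun e _ => ?_
    rw [lintegral_mul_const _ (hPmeas e), hPi]
  have hRm : ∀ (ω' : E → Utilities) (e : E), Measurable fun ω : E → Utilities =>
      (P e).indicator (1 : (E → Utilities) → ℝ≥0∞) ω *
        r (Function.update ω' e (ω e)) (insert e A) := fun ω' e =>
    (hPmeas e).mul ((hrm _).comp ((hupm ω' e).comp (measurable_pi_apply e)))
  have hR1 : ∀ ω' e, ∫⁻ ω, (P e).indicator 1 ω * r (Function.update ω' e (ω e)) (insert e A)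
      ∂I.prob = I.prob (P e) * ∫⁻ v, r (Function.update ω' e v) (insert e A)
        ∂(I.law e : Measure Utilities) := fun ω' e => by
    rw [Instance.prob, lintegral_pi_update _ e (hRm ω' e)]
    have : ∀ ω v, (P e).indicator (1 : (E → Utilities) → ℝ≥0∞) (Function.update ω e v) =
        (P e).indicator 1 ω := fun ω v => by
      simp only [Set.indicator, hP, Set.mem_ofPred_eq, Strategy.mem_probed_update]
      rfl
    simp only [this, Function.update_self]
    have : ∀ ω, ∫⁻ v, (P e).indicator (1 : (E → Utilities) → ℝ≥0∞) ω *
        r (Function.update ω' e v) (insert e A) ∂(I.law e : Measure Utilities) =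
        (P e).indicator (1 : (E → Utilities) → ℝ≥0∞) ω *
        ∫⁻ v, r (Function.update ω' e v) (insert e A) ∂(I.law e : Measure Utilities) := fun ω =>
      lintegral_const_mul _ ((hrm _).comp (hupm ω' e))
    simp only [this]
    rw [lintegral_mul_const _ (hPmeas e)]
    congr 1
    exact hPi e
  have hR : ∀ ω', ∫⁻ ω, (r ω' A + ∑ e, (P e).indicator 1 ω *
      r (Function.update ω' e (ω e)) (insert e A)) ∂I.prob = r ω' A + ∑ e, I.prob (P e) *
        ∫⁻ v, r (Function.update ω' e v) (insert e A) ∂(I.law e : Measure Utilities) := fun ω' => by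
    rw [lintegral_add_left measurable_const, lintegral_finsetSum _ fun e _ => hRm ω' e]
    simp only [hR1, lintegral_const, measure_univ, mul_one]
  simp only [hL, hR] at hint
  have hm3 : ∀ e, Measurable fun ω' : E → Utilities =>
      ∫⁻ v, r (Function.update ω' e v) (insert e A) ∂(I.law e : Measure Utilities) := fun e =>
    Measurable.lintegral_prod_right' (f := fun p : (E → Utilities) × Utilities =>
      r (Function.update p.1 e p.2) (insert e A))
      ((hrm _).comp (measurePreserving_update_pi (fun e => (I.law e : Measure Utilities)) e).1)
  rw [lintegral_add_left measurable_const, lintegral_add_left (hrm A),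
    lintegral_finsetSum _ fun e _ => (hrm _).const_mul _,
    lintegral_finsetSum _ fun e _ => (hm3 e).const_mul _] at hint
  simp only [lintegral_const_mul _ (hrm _), lintegral_const_mul _ (hm3 _), lintegral_const,
    measure_univ, mul_one] at hint
  have hfin : ∀ e, ∫⁻ ω', ∫⁻ v, r (Function.update ω' e v) (insert e A)
      ∂(I.law e : Measure Utilities) ∂I.prob = expectedRank I w (insert e A) := fun e =>
    (lintegral_pi_update (fun e => (I.law e : Measure Utilities)) e (hrm _)).symm
  simp only [hfin] at hint
  exact hint

end AdaptivityGap

section NonAdaptive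

variable {E : Type*} [Fintype E] [DecidableEq E]

theorem expectedRank_ne_top (I : Instance E) {w : E → Utilities → ℝ≥0}
    (hw : ∀ e, Measurable (w e))
    (hfin : ∀ e, ∫⁻ v, (w e v : ℝ≥0∞) ∂(I.law e : Measure Utilities) ≠ ∞) (A : Finset E) :
    expectedRank I w A ≠ ∞ :=
  lintegral_weightedRank_ne_top I hw hfin fun _ => A

theorem expectedRank_mono (I : Instance E) (w : E → Utilities → ℝ≥0) {A B : Finset E}
    (h : A ⊆ B) : expectedRank I w A ≤ expectedRank I w B :=
  lintegral_mono fun _ => ENNReal.coe_le_coe.2 (weightedRank_mono _ _ h)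

theorem expectedRank_submodular (I : Instance E) (hin : I.inner.IsMatroid)
    {w : E → Utilities → ℝ≥0} (hw : ∀ e, Measurable (w e)) {A : Finset E} {i j : E}
    (hi : i ∉ A) (hij : i ≠ j) :
    expectedRank I w (insert i (insert j A)) + expectedRank I w A ≤
      expectedRank I w (insert i A) + expectedRank I w (insert j A) := by
  have hm : ∀ F, Measurable fun ω : E → Utilities =>
      (weightedRank I.inner (fun e => w e (ω e)) F : ℝ≥0∞) := fun F =>
    (measurable_weightedRank I.inner hw F).coe_nnreal_ennreal
  simp only [expectedRank]
  rw [← lintegral_add_left (hm _), ← lintegral_add_left (hm _)]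
  refine lintegral_mono fun ω => ?_
  rw [← ENNReal.coe_add, ← ENNReal.coe_add]
  exact ENNReal.coe_le_coe.2 (weightedRank_submodular hin (fun e => w e (ω e)) hi hij)

theorem exists_nonadaptive (I : Instance E) (hout : I.outer.IsMatroid) (hin : I.inner.IsMatroid)
    {w : E → Utilities → ℝ≥0} (hw : ∀ e, Measurable (w e))
    (hfin : ∀ e, ∫⁻ v, (w e v : ℝ≥0∞) ∂(I.law e : Measure Utilities) ≠ ∞)
    {σ : Strategy E} (hσ : I.IsStrategy σ) :
    ∃ S, I.outer.feasible S ∧ ENNReal.ofReal (1 - 1 / Real.exp 1) *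
      ∫⁻ ω, (weightedRank I.inner (fun e => w e (ω e)) (σ.probed ω) : ℝ≥0∞) ∂I.prob ≤
        expectedRank I w S := by
  set V := ∫⁻ ω, (weightedRank I.inner (fun e => w e (ω e)) (σ.probed ω) : ℝ≥0∞) ∂I.prob with hV
  have hVtop : V ≠ ∞ := lintegral_weightedRank_ne_top I hw hfin σ.probed
  have htop := expectedRank_ne_top I hw hfin
  set f : Finset E → ℝ := fun A => (expectedRank I w A).toReal with hf
  set c : Finset E → ℝ := fun F => I.prob.real {ω | σ.probed ω = F} with hc
  have hmono : ∀ A B, A ⊆ B → f A ≤ f B := fun A B h =>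
    ENNReal.toReal_mono (htop B) (expectedRank_mono I w h)
  have hsub : ∀ A i j, i ∉ A → j ∉ A → i ≠ j →
      f (insert i (insert j A)) + f A ≤ f (insert i A) + f (insert j A) := fun A i j hi _ hij => by
    simp only [hf]
    rw [← ENNReal.toReal_add (htop _) (htop _), ← ENNReal.toReal_add (htop _) (htop _)]
    exact ENNReal.toReal_mono (ENNReal.add_ne_top.2 ⟨htop _, htop _⟩)
      (expectedRank_submodular I hin hw hi hij)
  have hc1 : ∑ A, c A = 1 := sum_measureReal_fiber hσ.2.1 I.prob
  have hq : ∀ e, ∑ A, c A * (if e ∈ A then 1 else 0) = I.prob.real {ω | e ∈ σ.probed ω} :=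
    fun e => (measureReal_mem_eq_sum hσ.2.1 I.prob e).symm
  obtain ⟨S, hS, hle⟩ := exists_feasible_multilinearExt_le hout hmono hsub (c := c)
    (fun _ => measureReal_nonneg) (fun A hA => by
      have : {ω | σ.probed ω = A} = ∅ := by
        ext ω
        simp only [Set.mem_ofPred_eq, Set.mem_empty_iff_false, iff_false]
        rintro rfl
        exact hA (hσ.feasible_probed ω)
      simp [hc, this]) hc1
  simp only [hq] at hle
  refine ⟨S, hS, ?_⟩
  have hmarg : ∀ A, V.toReal ≤ f A + ∑ e, I.prob.real {ω | e ∈ σ.probed ω} *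
      (f (insert e A) - f (A.erase e)) := by
    intro A
    have h := adaptive_add_sum_le I hin hw hσ.2 A
    have t : ∀ e (B : Finset E), I.prob {ω | e ∈ σ.probed ω} * expectedRank I w B ≠ ∞ := fun e B =>
      ENNReal.mul_ne_top (measure_ne_top _ _) (htop B)
    have t' : ∀ g : E → Finset E,
        ∑ e, I.prob {ω | e ∈ σ.probed ω} * expectedRank I w (g e) ≠ ∞ := fun g =>
      ENNReal.sum_ne_top.2 fun e _ => t e (g e)
    have h' := ENNReal.toReal_mono (ENNReal.add_ne_top.2 ⟨htop A, t' _⟩) h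
    rw [ENNReal.toReal_add hVtop (t' _), ENNReal.toReal_add (htop A) (t' _),
      ENNReal.toReal_sum fun e _ => t e _, ENNReal.toReal_sum fun e _ => t e _] at h'
    simp only [ENNReal.toReal_mul] at h'
    simp only [mul_sub, Finset.sum_sub_distrib, hf, Measure.real]
    linarith
  have hfin' := (le_multilinearExt_of_marginals (f := f) (fun e => measureReal_nonneg)
    (fun e => measureReal_le_one) ENNReal.toReal_nonneg hmarg).trans hle
  rw [← ENNReal.ofReal_toReal hVtop, ← ENNReal.ofReal_mul, ← ENNReal.ofReal_toReal (htop S)]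
  · exact ENNReal.ofReal_le_ofReal hfin'
  · have : 1 / Real.exp 1 ≤ 1 := by
      rw [div_le_one (Real.exp_pos 1)]
      exact Real.one_le_exp zero_le_one
    linarith

end NonAdaptive

section Derandomization

variable {E : Type*} [Fintype E] [DecidableEq E]

/-- A sum of weights that are discounted by multilinear factors. -/
def discountedSum (N : Finset E) (u : E → Finset E → ℝ) (W a : E → ℝ) : ℝ :=
  ∑ e ∈ N, W e * multilinearExt (u e) a

theorem exists_affine_discountedSum (N : Finset E) {u : E → Finset E → ℝ}
    (hu : ∀ e Q, u e (insert e Q) = u e (Q.erase e)) (W a : E → ℝ) (e : E) :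
    ∃ c₁ c₂ c₃ : ℝ, ∀ x y, discountedSum N u (Function.update W e x) (Function.update a e y) =
      c₁ * x + c₂ * y + c₃ := by
  refine ⟨∑ j ∈ N, if j = e then multilinearExt (u j) a else 0,
    ∑ j ∈ N, if j = e then 0 else W j * (multilinearExt (fun Q => u j (insert e Q)) a -
      multilinearExt (fun Q => u j (Q.erase e)) a),
    ∑ j ∈ N, if j = e then 0 else W j * multilinearExt (fun Q => u j (Q.erase e)) a,
    fun x y => ?_⟩
  rw [discountedSum, Finset.sum_mul, Finset.sum_mul, ← Finset.sum_add_distrib,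
    ← Finset.sum_add_distrib]
  refine Finset.sum_congr rfl fun j _ => ?_
  by_cases hj : j = e
  · subst hj
    rw [multilinearExt_update_of_eq (hu j)]
    simp [mul_comm]
  · rw [multilinearExt_update]
    simp only [hj, if_false, ne_eq, not_false_eq_true, Function.update_of_ne]
    ring

variable {U : Type*} [MeasurableSpace U] (μ : E → Measure U) [∀ e, IsProbabilityMeasure (μ e)]

theorem integrable_mul_of_unit {ν : Measure U} {k w : U → ℝ} (hk : Measurable k)
    (hk0 : ∀ v, 0 ≤ k v) (hk1 : ∀ v, k v ≤ 1) (hw : Integrable w ν) :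
    Integrable (fun v => k v * w v) ν :=
  hw.bdd_mul (c := 1) hk.aestronglyMeasurable (Filter.Eventually.of_forall fun v => by
    rw [Real.norm_eq_abs, abs_of_nonneg (hk0 v)]; exact hk1 v)

/-- Acceptance probabilities can be replaced by deterministic acceptance sets. -/
theorem exists_sets_discountedSum_le (N : Finset E) {u : E → Finset E → ℝ}
    (hu : ∀ e Q, u e (insert e Q) = u e (Q.erase e)) {w : E → U → ℝ}
    (hwm : ∀ e, Measurable (w e)) (hw : ∀ e, Integrable (w e) (μ e)) {k : E → U → ℝ}
    (hk : ∀ e, Measurable (k e)) (hk0 : ∀ e v, 0 ≤ k e v) (hk1 : ∀ e v, k e v ≤ 1) :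
    ∃ A : E → Set U, (∀ e, MeasurableSet (A e)) ∧
      discountedSum N u (fun e => ∫ v, k e v * w e v ∂(μ e)) (fun e => ∫ v, k e v ∂(μ e)) ≤
      discountedSum N u (fun e => ∫ v in A e, w e v ∂(μ e)) (fun e => (μ e).real (A e)) := by
  set val : (E → U → ℝ) → ℝ := fun k =>
    discountedSum N u (fun e => ∫ v, k e v * w e v ∂(μ e)) (fun e => ∫ v, k e v ∂(μ e)) with hval
  have hstep : ∀ s : Finset E, ∃ k' : E → U → ℝ, (∀ e, Measurable (k' e)) ∧ (∀ e v, 0 ≤ k' e v) ∧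
      (∀ e v, k' e v ≤ 1) ∧ (∀ e ∈ s, ∃ A, MeasurableSet A ∧ k' e = A.indicator 1) ∧
      val k ≤ val k' := by
    intro s
    induction s using Finset.induction_on with
    | empty => exact ⟨k, hk, hk0, hk1, by simp, le_rfl⟩
    | insert e s he ih =>
      obtain ⟨k', hm, h0, h1, hA, hle⟩ := ih
      obtain ⟨c₁, c₂, c₃, hc⟩ := exists_affine_discountedSum N hu
        (fun e => ∫ v, k' e v * w e v ∂(μ e)) (fun e => ∫ v, k' e v ∂(μ e)) e
      set B : Set U := {v | 0 ≤ c₁ * w e v + c₂} with hB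
      have hBm : MeasurableSet B :=
        measurableSet_le measurable_const (((hwm e).const_mul c₁).add_const c₂)
      have hBi : ∀ v, 0 ≤ B.indicator (1 : U → ℝ) v ∧ B.indicator (1 : U → ℝ) v ≤ 1 := fun v => by
        by_cases hv : v ∈ B <;> simp [hv]
      have hvalk : ∀ g : U → ℝ, val (Function.update k' e g) =
          c₁ * ∫ v, g v * w e v ∂(μ e) + c₂ * ∫ v, g v ∂(μ e) + c₃ := fun g => by
        rw [← hc]
        simp only [hval]
        congr 1
        · funext j
          by_cases hj : j = e
          · subst hj; simp
          · simp [hj]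
        · funext j
          by_cases hj : j = e
          · subst hj; simp
          · simp [hj]
      have hcomb : ∀ g : U → ℝ, Measurable g → (∀ v, 0 ≤ g v) → (∀ v, g v ≤ 1) →
          Integrable (fun v => g v * (c₁ * w e v + c₂)) (μ e) ∧
          c₁ * ∫ v, g v * w e v ∂(μ e) + c₂ * ∫ v, g v ∂(μ e) =
            ∫ v, g v * (c₁ * w e v + c₂) ∂(μ e) := fun g hg hg0 hg1 => by
        have i1 := (integrable_mul_of_unit hg hg0 hg1 (hw e)).const_mul c₁
        have i2 := (integrable_mul_of_unit hg hg0 hg1 (integrable_const (1 : ℝ))).const_mul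
          (μ := μ e) c₂
        simp only [mul_one] at i2
        have heq : (fun v => g v * (c₁ * w e v + c₂)) =
            fun v => c₁ * (g v * w e v) + c₂ * g v := by
          funext v; ring
        rw [heq, integral_add i1 i2, integral_const_mul, integral_const_mul]
        exact ⟨i1.add i2, rfl⟩
      refine ⟨Function.update k' e (B.indicator 1), fun j => ?_, fun j v => ?_, fun j v => ?_,
        fun j hj => ?_, hle.trans ?_⟩
      · by_cases hj : j = e
        · subst hj
          simpa using measurable_one.indicator hBm
        · simpa [hj] using hm j
      · by_cases hj : j = e
        · subst hj
          simpa using (hBi v).1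
        · simpa [hj] using h0 j v
      · by_cases hj : j = e
        · subst hj
          simpa using (hBi v).2
        · simpa [hj] using h1 j v
      · by_cases hje : j = e
        · subst hje
          exact ⟨B, hBm, by simp⟩
        · simpa [hje] using hA j ((Finset.mem_insert.1 hj).resolve_left hje)
      · conv_lhs => rw [← Function.update_eq_self e k']
        obtain ⟨j1, e1⟩ := hcomb (k' e) (hm e) (h0 e) (h1 e)
        obtain ⟨j2, e2⟩ := hcomb (B.indicator 1) (measurable_one.indicator hBm)
          (fun v => (hBi v).1) (fun v => (hBi v).2)
        rw [hvalk, hvalk, e1, e2]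
        refine add_le_add (integral_mono j1 j2 fun v => ?_) le_rfl
        dsimp only
        by_cases hv : v ∈ B
        · rw [Set.indicator_of_mem hv, Pi.one_apply]
          exact mul_le_mul_of_nonneg_right (h1 e v) hv
        · rw [Set.indicator_of_notMem hv, zero_mul]
          exact mul_nonpos_of_nonneg_of_nonpos (h0 e v) (not_le.1 hv).le
  obtain ⟨k', -, -, -, hA, hle⟩ := hstep Finset.univ
  choose A hAm hAk using fun e => hA e (Finset.mem_univ e)
  refine ⟨A, hAm, hle.trans (le_of_eq ?_)⟩
  simp only [hval]
  congr 1
  · funext e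
    rw [hAk, ← integral_indicator (hAm e)]
    congr 1
    funext v
    by_cases hv : v ∈ A e <;> simp [hv]
  · funext e
    rw [hAk, integral_indicator_one (hAm e)]

theorem lintegral_active_discounted {A : E → Set U} (hA : ∀ e, MeasurableSet (A e)) (N : Finset E)
    {u : E → Finset E → ℝ} (hu : ∀ e Q, u e (insert e Q) = u e (Q.erase e))
    (hu0 : ∀ e Q, 0 ≤ u e Q) {w : E → U → ℝ≥0} (hwm : ∀ e, Measurable (w e))
    (hw : ∀ e, Integrable (fun v => (w e v : ℝ)) (μ e)) :
    ENNReal.ofReal (discountedSum N u (fun e => ∫ v in A e, (w e v : ℝ) ∂(μ e))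
      (fun e => (μ e).real (A e))) =
    ∫⁻ ω, ∑ e ∈ N, (A e).indicator (fun v => (w e v : ℝ≥0∞)) (ω e) *
      ENNReal.ofReal (u e (activeSet A ω)) ∂(Measure.pi μ) := by
  have hm1 : ∀ e, Measurable ((A e).indicator fun v => (w e v : ℝ≥0∞)) := fun e =>
    (hwm e).coe_nnreal_ennreal.indicator (hA e)
  have hm2 : ∀ e, Measurable fun ω : E → U => ENNReal.ofReal (u e (activeSet A ω)) := fun e =>
    measurable_comp_fiber (measurableSet_activeSet_eq hA) (Φ := fun Q _ => ENNReal.ofReal (u e Q))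
      fun _ => measurable_const
  have hm3 : ∀ e, Measurable fun ω : E → U =>
      (A e).indicator (fun v => (w e v : ℝ≥0∞)) (ω e) * ENNReal.ofReal (u e (activeSet A ω)) :=
    fun e => ((hm1 e).comp (measurable_pi_apply e)).mul (hm2 e)
  have hp0 : ∀ e, 0 ≤ multilinearExt (u e) fun e => (μ e).real (A e) := fun e =>
    multilinearExt_nonneg (fun e => measureReal_nonneg) (fun e => measureReal_le_one) (hu0 e)
  have hW0 : ∀ e, 0 ≤ ∫ v in A e, (w e v : ℝ) ∂(μ e) := fun e =>
    integral_nonneg fun v => NNReal.coe_nonneg _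
  rw [lintegral_finsetSum _ fun e _ => hm3 e, discountedSum,
    ENNReal.ofReal_sum_of_nonneg fun e _ => mul_nonneg (hW0 e) (hp0 e)]
  refine Finset.sum_congr rfl fun e _ => ?_
  rw [lintegral_pi_update μ e (hm3 e)]
  have hu' : ∀ Q, u e Q = u e (Q.erase e) := fun Q => by
    by_cases h : e ∈ Q
    · rw [← hu, Finset.insert_eq_of_mem h]
    · rw [Finset.erase_eq_of_notMem h]
  have hinv : ∀ ω v, u e (activeSet A (Function.update ω e v)) = u e (activeSet A ω) := fun ω v => by
    rw [hu', hu' (activeSet A ω)]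
    congr 1
    ext j
    by_cases hj : j = e
    · subst hj; simp
    · simp [hj, mem_activeSet]
  simp only [hinv, Function.update_self]
  simp only [lintegral_mul_const _ (hm1 e)]
  rw [lintegral_const_mul _ (hm2 e), lintegral_activeSet μ hA (hu0 e), ENNReal.ofReal_mul (hW0 e),
    lintegral_indicator (hA e), ofReal_integral_eq_lintegral_ofReal (hw e).integrableOn
      (Filter.Eventually.of_forall fun v => NNReal.coe_nonneg _)]
  simp

end Derandomization

section Thresholds

theorem isBlocked_insert_iff {E : Type*} [DecidableEq E] (FF : Set (Finset E)) (e : E) (Q : Finset E) :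
    IsBlocked FF e (insert e Q) ↔ IsBlocked FF e (Q.erase e) := by
  simp only [IsBlocked, Finset.erase_insert_eq_erase, Finset.erase_idem]

variable {E : Type*} [Fintype E] [DecidableEq E]

theorem exists_measurable_optimum (I : Instance E) {w : E → Utilities → ℝ≥0}
    (hw : ∀ e, Measurable (w e)) (S : Finset E) :
    ∃ g : (E → Utilities) → Finset E, (∀ ω, g ω ⊆ S ∧ I.inner.feasible (g ω) ∧
      weightedRank I.inner (fun e => w e (ω e)) S = ∑ e ∈ g ω, w e (ω e)) ∧
      ∀ G, MeasurableSet {ω | g ω = G} := by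
  classical
  have hm : ∀ G : Finset E, Measurable fun ω : E → Utilities => ∑ e ∈ G, w e (ω e) := fun G =>
    Finset.measurable_sum _ fun e _ => (hw e).comp (measurable_pi_apply e)
  obtain ⟨g, hg, hgm⟩ := exists_measurable_argmax
    (fun (ω : E → Utilities) (G : Finset E) => ∑ e ∈ G, w e (ω e))
    (C := S.powerset.filter I.inner.feasible)
    ⟨∅, by simpa using I.inner.empty_feasible⟩ fun i _ j _ => measurableSet_le (hm i) (hm j)
  refine ⟨g, fun ω => ?_, hgm⟩
  obtain ⟨h1, h2⟩ := hg ω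
  rw [Finset.mem_filter, Finset.mem_powerset] at h1
  refine ⟨h1.1, h1.2, (le_antisymm ?_ (sum_le_weightedRank h1.1 h1.2))⟩
  obtain ⟨G, hG1, hG2, hG⟩ := exists_weightedRank_eq I.inner (fun e => w e (ω e)) S
  rw [hG]
  exact h2 G (by simp [hG1, hG2])

theorem sum_measureReal_mem_le_realRank {Ω : Type*} [MeasurableSpace Ω] (μ : Measure Ω)
    [IsProbabilityMeasure μ] {N : Matroid E} {g : Ω → Finset E}
    (hgm : ∀ G, MeasurableSet {ω | g ω = G}) (hg : ∀ ω, N.Indep (g ω)) (B : Finset E) :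
    ∑ e ∈ B, μ.real {ω | e ∈ g ω} ≤ realRank N B := by
  simp only [measureReal_mem_eq_sum hgm μ]
  rw [Finset.sum_comm]
  calc ∑ G, ∑ e ∈ B, μ.real {ω | g ω = G} * (if e ∈ G then (1 : ℝ) else 0)
      ≤ ∑ G, μ.real {ω | g ω = G} * realRank N B := by
        refine Finset.sum_le_sum fun G _ => ?_
        rw [← Finset.mul_sum]
        by_cases hG : N.Indep (G : Set E)
        · refine mul_le_mul_of_nonneg_left ?_ measureReal_nonneg
          rw [← Finset.sum_filter, Finset.sum_const, nsmul_eq_mul, mul_one,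
            Finset.filter_mem_eq_inter]
          exact card_le_realRank (hG.subset (by simp)) (by simp)
        · have : {ω | g ω = G} = ∅ := by
            ext ω
            simp only [Set.mem_ofPred_eq, Set.mem_empty_iff_false, iff_false]
            rintro rfl
            exact hG (hg ω)
          simp [this]
    _ = realRank N B := by
        rw [← Finset.sum_mul, sum_measureReal_fiber hgm μ, one_mul]

open Classical in
/-- For every fixed set of probed elements there are deterministic acceptance sets and a family of
feasible sets such that the elements that are active and not blocked are worth a quarter of the
expected weighted rank. -/
theorem exists_acceptance (I : Instance E) (hin : I.inner.IsMatroid)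
    {w : E → Utilities → ℝ≥0} (hw : ∀ e, Measurable (w e))
    (hfin : ∀ e, ∫⁻ v, (w e v : ℝ≥0∞) ∂(I.law e : Measure Utilities) ≠ ∞) (S : Finset E) :
    ∃ (FF : Set (Finset E)) (A : E → Set Utilities), ∅ ∈ FF ∧
      (∀ G ∈ FF, G ⊆ S ∧ I.inner.feasible G) ∧ (∀ e, MeasurableSet (A e)) ∧
      ENNReal.ofReal (1 / 4) * expectedRank I w S ≤
        ∫⁻ ω, ∑ e ∈ S, (A e).indicator (fun v => (w e v : ℝ≥0∞)) (ω e) *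
          (if IsBlocked FF e (activeSet A ω) then 0 else 1) ∂I.prob := by
  obtain ⟨M, hME, hM⟩ := hin
  obtain ⟨g, hg, hgm⟩ := exists_measurable_optimum I hw S
  set μ : E → Measure Utilities := fun e => (I.law e : Measure Utilities) with hμ
  have hprob : I.prob = Measure.pi μ := rfl
  set P : E → Set (E → Utilities) := fun e => {ω | e ∈ g ω} with hP
  have hPm : ∀ e, MeasurableSet (P e) := fun e => measurableSet_of_fiber hgm fun F => e ∈ F
  set k : E → Utilities → ℝ := fun e v =>
    I.prob.real {ω | Function.update ω e v ∈ P e} with hk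
  have hpm : ∀ e, MeasurableSet {p : Utilities × (E → Utilities) |
      Function.update p.2 e p.1 ∈ P e} := fun e =>
    ((measurePreserving_update_pi μ e).measurable.comp measurable_swap) (hPm e)
  have hkE : ∀ e, Measurable fun v => I.prob {ω | Function.update ω e v ∈ P e} := fun e =>
    measurable_measure_prodMk_left (hpm e)
  have hkm : ∀ e, Measurable (k e) := fun e => (hkE e).ennreal_toReal
  have hk0 : ∀ e v, 0 ≤ k e v := fun e v => measureReal_nonneg
  have hk1 : ∀ e v, k e v ≤ 1 := fun e v => measureReal_le_one
  have hwm : ∀ e, Measurable fun v => (w e v : ℝ) := fun e => (hw e).coe_nnreal_real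
  have hwi : ∀ e, Integrable (fun v => (w e v : ℝ)) (μ e) := fun e =>
    ⟨(hwm e).aestronglyMeasurable, by
      simpa [HasFiniteIntegral, lt_top_iff_ne_top, enorm_eq_nnnorm] using hfin e⟩
  have hslice : ∀ e v, ∫⁻ ω, (P e).indicator (1 : (E → Utilities) → ℝ≥0∞)
      (Function.update ω e v) ∂I.prob = ENNReal.ofReal (k e v) := fun e v => by
    have hmv : MeasurableSet {ω | Function.update ω e v ∈ P e} := measurable_prodMk_left (hpm e)
    rw [hk, ofReal_measureReal, ← lintegral_indicator_one hmv]
    rfl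
  have hka : ∀ e, ∫ v, k e v ∂(μ e) = I.prob.real (P e) := fun e => by
    rw [integral_eq_lintegral_of_nonneg_ae (Filter.Eventually.of_forall (hk0 e))
      (hkm e).aestronglyMeasurable, Measure.real, ← lintegral_indicator_one (hPm e), hprob,
      lintegral_pi_update_swap μ e (measurable_one.indicator (hPm e))]
    simp only [← hprob, hslice]
  have hkw : ∀ e, ENNReal.ofReal (∫ v, k e v * w e v ∂(μ e)) =
      ∫⁻ ω, (w e (ω e) : ℝ≥0∞) * (P e).indicator 1 ω ∂I.prob := fun e => by
    have hm : Measurable fun ω : E → Utilities => (w e (ω e) : ℝ≥0∞) * (P e).indicator 1 ω :=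
      ((hw e).comp (measurable_pi_apply e)).coe_nnreal_ennreal.mul
        (measurable_one.indicator (hPm e))
    rw [hprob, lintegral_pi_update_swap μ e hm, ofReal_integral_eq_lintegral_ofReal
      (integrable_mul_of_unit (hkm e) (hk0 e) (hk1 e) (hwi e))
      (Filter.Eventually.of_forall fun v => mul_nonneg (hk0 e v) (NNReal.coe_nonneg _))]
    refine lintegral_congr fun v => ?_
    simp only [Function.update_self]
    rw [lintegral_const_mul, ← hprob, hslice, ENNReal.ofReal_mul (hk0 e v), mul_comm,
      ENNReal.ofReal_coe_nnreal]
    exact (measurable_one.indicator (hPm e)).comp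
      ((measurePreserving_update_pi μ e).measurable.comp measurable_prodMk_right)
  set N : Finset E := S.filter fun e => I.inner.feasible {e} with hN
  have hgN : ∀ ω, g ω ⊆ N := fun ω e he =>
    Finset.mem_filter.2 ⟨(hg ω).1 he, I.inner.down_closed _ _
      (Finset.singleton_subset_iff.2 he) (hg ω).2.1⟩
  have hfS : expectedRank I w S = ENNReal.ofReal (∑ e ∈ N, ∫ v, k e v * w e v ∂(μ e)) := by
    rw [ENNReal.ofReal_sum_of_nonneg fun e _ =>
      integral_nonneg fun v => mul_nonneg (hk0 e v) (NNReal.coe_nonneg _)]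
    simp only [hkw]
    have hm : ∀ e, Measurable fun ω : E → Utilities => (w e (ω e) : ℝ≥0∞) * (P e).indicator 1 ω :=
      fun e => ((hw e).comp (measurable_pi_apply e)).coe_nnreal_ennreal.mul
        (measurable_one.indicator (hPm e))
    rw [← lintegral_finsetSum _ fun e _ => hm e, expectedRank]
    refine lintegral_congr fun ω => ?_
    rw [(hg ω).2.2, ENNReal.ofNNReal_finsetSum, ← Finset.sum_subset (hgN ω)]
    · refine Finset.sum_congr rfl fun e he => ?_
      rw [Set.indicator_of_mem (show ω ∈ P e from he)]
      simp
    · intro e _ he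
      rw [Set.indicator_of_notMem (show ω ∉ P e from he), mul_zero]
  set a : E → ℝ := fun e => 1 / 2 * I.prob.real (P e) with ha
  have ha0 : ∀ e, 0 ≤ a e := fun e => mul_nonneg (by norm_num) measureReal_nonneg
  have ha1 : ∀ e, a e ≤ 1 := fun e => by
    have : I.prob.real (P e) ≤ 1 := measureReal_le_one
    simp only [ha]; linarith
  obtain ⟨FF, hFF0, hFF, hFFb⟩ := exists_contention_resolution hME ha0 ha1
    (b := 1 / 2) (by norm_num) N (fun e he => by
      have := (hM _).1 (Finset.mem_filter.1 he).2
      simpa using this) (fun B _ => by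
      simp only [ha]
      rw [← Finset.mul_sum]
      exact mul_le_mul_of_nonneg_left (sum_measureReal_mem_le_realRank I.prob hgm
        (fun ω => (hM _).1 (hg ω).2.1) B) (by norm_num))
  set u : E → Finset E → ℝ := fun e Q => if IsBlocked FF e Q then 0 else 1 with hu
  have hui : ∀ e Q, u e (insert e Q) = u e (Q.erase e) := fun e Q => by
    simp only [hu, isBlocked_insert_iff]
  have hu0 : ∀ e Q, 0 ≤ u e Q := fun e Q => by
    simp only [hu]; split_ifs <;> norm_num
  obtain ⟨A, hA, hAle⟩ := exists_sets_discountedSum_le μ N hui hwm hwi (k := fun e v => 1 / 2 * k e v)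
    (fun e => (hkm e).const_mul _) (fun e v => mul_nonneg (by norm_num) (hk0 e v))
    (fun e v => by linarith [hk1 e v])
  refine ⟨FF, A, hFF0, fun G hG => ⟨(hFF G hG).1.trans (Finset.filter_subset _ _),
    (hM G).2 (hFF G hG).2⟩, hA, ?_⟩
  have hlow : 1 / 4 * ∑ e ∈ N, ∫ v, k e v * w e v ∂(μ e) ≤
      discountedSum N u (fun e => ∫ v, 1 / 2 * k e v * w e v ∂(μ e))
        (fun e => ∫ v, 1 / 2 * k e v ∂(μ e)) := by
    have e1 : (fun e => ∫ v, 1 / 2 * k e v ∂(μ e)) = a := by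
      funext e
      rw [integral_const_mul, hka]
    rw [e1, discountedSum, Finset.mul_sum]
    refine Finset.sum_le_sum fun e he => ?_
    have e2 : ∫ v, 1 / 2 * k e v * w e v ∂(μ e) = 1 / 2 * ∫ v, k e v * w e v ∂(μ e) := by
      rw [← integral_const_mul]
      simp only [mul_assoc]
    have e3 : multilinearExt (u e) a =
        1 - multilinearExt (fun Q => if IsBlocked FF e Q then 1 else 0) a := by
      have hsub := multilinearExt_sub (fun _ => 1) (fun Q => if IsBlocked FF e Q then 1 else 0) a
      rw [multilinearExt_const] at hsub
      rw [← hsub]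
      congr 1
      funext Q
      simp only [hu]
      split_ifs <;> norm_num
    have h0 : 0 ≤ ∫ v, k e v * w e v ∂(μ e) :=
      integral_nonneg fun v => mul_nonneg (hk0 e v) (NNReal.coe_nonneg _)
    rw [e2, e3]
    nlinarith [hFFb e he]
  rw [hfS, ← ENNReal.ofReal_mul (by norm_num)]
  refine (ENNReal.ofReal_le_ofReal (hlow.trans hAle)).trans ?_
  rw [lintegral_active_discounted μ hA N hui hu0 hw hwi, ← hprob]
  refine lintegral_mono fun ω => ?_
  refine le_trans (le_of_eq (Finset.sum_congr rfl fun e _ => ?_))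
    (Finset.sum_le_sum_of_subset (Finset.filter_subset _ S))
  simp only [hu]
  split_ifs <;> simp

end Thresholds

section ProbeAll

variable {E : Type*} [DecidableEq E]

/-- Probe all elements of the list and propose the set that `g` assigns to the observed utilities,
where `acc` provides the utilities of the elements outside the list. -/
def Strategy.probeAll (g : (E → Utilities) → Finset E) : List E → (E → Utilities) → Strategy E
  | [], acc => .propose (g acc)
  | e :: l, acc => .probe e fun v => probeAll g l (Function.update acc e v)

theorem Strategy.probed_probeAll (g : (E → Utilities) → Finset E) (l : List E)
    (acc ω : E → Utilities) : (Strategy.probeAll g l acc).probed ω = l.toFinset := by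
  induction l generalizing acc with
  | nil => rfl
  | cons e l ih => simp [Strategy.probeAll, Strategy.probed, ih]

theorem Strategy.proposal_probeAll (g : (E → Utilities) → Finset E) (l : List E)
    (acc ω : E → Utilities) :
    (Strategy.probeAll g l acc).proposal ω = g fun e => if e ∈ l then ω e else acc e := by
  induction l generalizing acc with
  | nil => simp [Strategy.probeAll, Strategy.proposal]
  | cons e l ih =>
    simp only [Strategy.probeAll, Strategy.proposal, ih]
    congr 1
    funext j
    by_cases hj : j = e
    · subst hj; simp
    · simp [hj]

theorem Strategy.feasibleFrom_probeAll {M : SetSystem E} (g : (E → Utilities) → Finset E)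
    (l : List E) (hl : l.Nodup) : ∀ (F : Finset E) (acc : E → Utilities), (∀ e ∈ l, e ∉ F) →
      M.feasible (F ∪ l.toFinset) → (Strategy.probeAll g l acc).FeasibleFrom M F := by
  induction l with
  | nil => intros; trivial
  | cons e l ih =>
    intro F acc hd hF
    rw [List.nodup_cons] at hl
    rw [List.toFinset_cons, Finset.union_insert, ← Finset.insert_union] at hF
    refine ⟨hd e (by simp), M.down_closed _ _ Finset.subset_union_left hF,
      fun v => ih hl.2 _ _ (fun j hj => ?_) hF⟩
    rw [Finset.mem_insert, not_or]
    refine ⟨?_, hd j (by simp [hj])⟩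
    rintro rfl
    exact hl.1 hj

theorem Instance.isStrategy_probeAll (I : Instance E) {g : (E → Utilities) → Finset E}
    (hg : ∀ G, MeasurableSet {ω | g ω = G}) {L : Finset E} (hL : I.outer.feasible L)
    (acc : E → Utilities) : I.IsStrategy (Strategy.probeAll g L.toList acc) := by
  refine ⟨Strategy.feasibleFrom_probeAll g _ L.nodup_toList ∅ acc (by simp) (by simpa using hL),
    fun F => ?_, fun G => ?_⟩
  · simp only [Strategy.probed_probeAll]
    exact MeasurableSet.const _
  · simp only [Strategy.proposal_probeAll]
    have hm : Measurable fun ω : E → Utilities => fun e => if e ∈ L.toList then ω e else acc e := by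
      refine measurable_pi_iff.2 fun e => ?_
      by_cases he : e ∈ L.toList
      · simp only [he, if_true]; exact measurable_pi_apply e
      · simp only [he, if_false]; exact measurable_const
    exact hm (hg G)

end ProbeAll

section Policy

variable {E : Type*}

theorem yUtil_mono {G G' : Finset E} (h : G ⊆ G') (ω : E → Utilities) :
    yUtil G ω ≤ yUtil G' ω :=
  Finset.sum_le_sum_of_subset h

theorem measurable_yUtil (G : Finset E) : Measurable fun ω : E → Utilities => yUtil G ω :=
  Finset.measurable_sum _ fun e _ =>
    (measurable_snd.comp (measurable_pi_apply e)).coe_nnreal_ennreal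

variable [DecidableEq E]

theorem mem_outcomes {G : Finset E} {ω : E → Utilities} {o : Outcome E} :
    o ∈ outcomes G ω ↔ ∃ e ∈ G, (e, ω e) = o :=
  Finset.mem_map

theorem outcomes_congr {G : Finset E} {ω ω' : E → Utilities} (h : ∀ e ∈ G, ω e = ω' e) :
    outcomes G ω = outcomes G ω' := by
  ext o
  simp only [mem_outcomes]
  exact exists_congr fun e => and_congr_right fun he => by rw [h e he]

theorem mem_relevant_of_outcomes_mem {R : Set (Finset (Outcome E))} {G : Finset E}
    {ω : E → Utilities} (h : outcomes G ω ∈ R) {e : E} (he : e ∈ G) : e ∈ relevant R :=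
  ⟨_, h, (e, ω e), mem_outcomes.2 ⟨e, he, rfl⟩, rfl⟩

theorem accepted_eq_empty_or (R : Set (Finset (Outcome E))) (σ : Strategy E) (ω : E → Utilities) :
    accepted R σ ω = ∅ ∨ outcomes (accepted R σ ω) ω ∈ R := by
  unfold accepted
  split_ifs with h
  · exact Or.inr h.2
  · exact Or.inl rfl

theorem yUtil_accepted_le {R : Set (Finset (Outcome E))} {σ : Strategy E} {ω : E → Utilities}
    {c : ℝ≥0∞} (h : ∀ G, outcomes G ω ∈ R → yUtil G ω ≤ c) : yUtil (accepted R σ ω) ω ≤ c := by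
  rcases accepted_eq_empty_or R σ ω with h' | h'
  · rw [h']; simp [yUtil]
  · exact h _ h'

/-- The policy that accepts the sets of a family `FF` whose outcomes lie in prescribed sets. -/
def familyPolicy (I : Instance E) (FF : Set (Finset E)) (A : E → Set Utilities) :
    Set (Finset (Outcome E)) :=
  {T | T ∈ I.innerOutcomes ∧ (∀ o ∈ T, o.2 ∈ A o.1) ∧ T.image Prod.fst ∈ FF}

theorem relevant_familyPolicy_subset {I : Instance E} {FF : Set (Finset E)}
    {A : E → Set Utilities} {S : Finset E} (hFF : ∀ G ∈ FF, G ⊆ S) :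
    relevant (familyPolicy I FF A) ⊆ S := by
  rintro e ⟨T, hT, o, ho, rfl⟩
  exact hFF _ hT.2.2 (Finset.mem_image_of_mem _ ho)

theorem outcomes_mem_familyPolicy {I : Instance E} {FF : Set (Finset E)} {A : E → Set Utilities}
    (hFF : ∀ G ∈ FF, I.inner.feasible G) {G : Finset E} {ω : E → Utilities} :
    outcomes G ω ∈ familyPolicy I FF A ↔ G ∈ FF ∧
      ∀ e ∈ G, ω e ∈ A e ∧ ω e ∈ (I.law e : Measure Utilities).support := by
  have himg : (outcomes G ω).image Prod.fst = G := by
    ext e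
    simp only [Finset.mem_image, mem_outcomes]
    exact ⟨by rintro ⟨_, ⟨j, hj, rfl⟩, rfl⟩; exact hj, fun he => ⟨_, ⟨e, he, rfl⟩, rfl⟩⟩
  have hall : ∀ p : Outcome E → Prop, (∀ o ∈ outcomes G ω, p o) ↔ ∀ e ∈ G, p (e, ω e) := by
    intro p
    simp only [mem_outcomes]
    exact ⟨fun h e he => h _ ⟨e, he, rfl⟩, by rintro h _ ⟨e, he, rfl⟩; exact h e he⟩
  simp only [familyPolicy, Instance.innerOutcomes, Set.mem_ofPred_eq, himg, hall]
  constructor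
  · rintro ⟨⟨h1, -, -⟩, h2, h3⟩
    exact ⟨h3, fun e he => ⟨h2 e he, h1 e he⟩⟩
  · rintro ⟨h1, h2⟩
    refine ⟨⟨fun e he => (h2 e he).2, ?_, hFF G h1⟩, fun e he => (h2 e he).1, h1⟩
    intro o ho o' ho' h
    obtain ⟨e, _, rfl⟩ := mem_outcomes.1 ho
    obtain ⟨e', _, rfl⟩ := mem_outcomes.1 ho'
    obtain rfl : e = e' := h
    rfl

theorem isPolicy_familyPolicy {I : Instance E} {FF : Set (Finset E)} {A : E → Set Utilities}
    (hFF : ∀ G ∈ FF, I.inner.feasible G) (hA : ∀ e, MeasurableSet (A e)) :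
    I.IsPolicy (familyPolicy I FF A) := by
  refine ⟨fun T hT => hT.1, fun G => ?_⟩
  simp only [outcomes_mem_familyPolicy hFF]
  refine (MeasurableSet.const (G ∈ FF)).inter ?_
  have : {ω : E → Utilities | ∀ e ∈ G, ω e ∈ A e ∧ ω e ∈ (I.law e : Measure Utilities).support} =
      ⋂ e ∈ G, (fun ω : E → Utilities => ω e) ⁻¹'
        (A e ∩ (I.law e : Measure Utilities).support) := by
    ext ω
    simp
  change MeasurableSet {ω : E → Utilities | ∀ e ∈ G, ω e ∈ A e ∧
    ω e ∈ (I.law e : Measure Utilities).support}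
  rw [this]
  exact Finset.measurableSet_biInter _ fun e _ => measurable_pi_apply e ((hA e).inter
    Measure.isClosed_support.measurableSet)

/-- If all relevant elements can be probed, some strategy probes exactly these, attains the largest
utility of the agent in every state, and has an inclusion-maximal set accepted. -/
theorem exists_optimal_strategy {I : Instance E} {R : Set (Finset (Outcome E))}
    (hR : I.IsPolicy R) {S : Finset E} (hS : I.outer.feasible S) (hRS : relevant R ⊆ S) :
    ∃ σ, I.IsStrategy σ ∧ (∀ ω e, e ∈ σ.probed ω ↔ e ∈ relevant R) ∧
      ∀ ω G, outcomes G ω ∈ R → yUtil G ω ≤ yUtil (accepted R σ ω) ω ∧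
        (accepted R σ ω ⊆ G → accepted R σ ω = G) := by
  classical
  set L : Finset E := S.filter fun e => e ∈ relevant R with hL
  have hLmem : ∀ e, e ∈ L ↔ e ∈ relevant R := fun e => by
    rw [hL, Finset.mem_filter]
    exact ⟨fun h => h.2, fun h => ⟨hRS h, h⟩⟩
  set s₁ : (E → Utilities) → Finset E → ℝ≥0∞ := fun ω G =>
    if outcomes G ω ∈ R then yUtil G ω else 0 with hs₁
  set s₂ : (E → Utilities) → Finset E → ℕ := fun ω G =>
    if outcomes G ω ∈ R then G.card + 1 else 0 with hs₂
  have hm₁ : ∀ G, Measurable fun ω => s₁ ω G := fun G =>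
    Measurable.ite (hR.2 G) (measurable_yUtil G) measurable_const
  have hm₂ : ∀ G, Measurable fun ω => s₂ ω G := fun G =>
    Measurable.ite (hR.2 G) measurable_const measurable_const
  obtain ⟨g, hg, hgm⟩ := exists_measurable_argmax (fun ω G => toLex (s₁ ω G, s₂ ω G))
    (C := L.powerset) ⟨∅, by simp⟩ fun G _ G' _ => by
      simp only [Prod.Lex.toLex_le_toLex]
      exact (measurableSet_lt (hm₁ G) (hm₁ G')).union
        ((measurableSet_eq_fun (hm₁ G) (hm₁ G')).inter (measurableSet_le (hm₂ G) (hm₂ G')))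
  refine ⟨Strategy.probeAll g L.toList 0, I.isStrategy_probeAll hgm
    (I.outer.down_closed _ _ (Finset.filter_subset _ _) hS) 0, fun ω e => ?_, fun ω G hG => ?_⟩
  · rw [Strategy.probed_probeAll, Finset.toList_toFinset]
    exact hLmem e
  · have hGL : G ⊆ L := fun e he => (hLmem e).2 (mem_relevant_of_outcomes_mem hG he)
    set ω' : E → Utilities := fun e => if e ∈ L.toList then ω e else (0 : E → Utilities) e with hω'
    have hagree : ∀ H ⊆ L, ∀ e ∈ H, ω' e = ω e := fun H hH e he => by
      simp [hω', hH he]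
    have ho : ∀ H ⊆ L, outcomes H ω' = outcomes H ω := fun H hH => outcomes_congr (hagree H hH)
    have hy : ∀ H ⊆ L, yUtil H ω' = yUtil H ω := fun H hH =>
      Finset.sum_congr rfl fun e he => by rw [hagree H hH e he]
    obtain ⟨hpL, hp⟩ := hg ω'
    rw [Finset.mem_powerset] at hpL
    have hle := hp G (Finset.mem_powerset.2 hGL)
    simp only [Prod.Lex.toLex_le_toLex, hs₁, hs₂, ho G hGL, ho _ hpL, hy G hGL, hy _ hpL, if_pos hG]
      at hle
    have hpR : outcomes (g ω') ω ∈ R := by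
      by_contra h
      simp only [if_neg h] at hle
      rcases hle with h | h
      · exact not_lt_zero h
      · omega
    simp only [if_pos hpR] at hle
    have hacc : accepted R (Strategy.probeAll g L.toList 0) ω = g ω' := by
      rw [accepted, Strategy.proposal_probeAll, Strategy.probed_probeAll, if_pos]
      exact ⟨by rw [Finset.toList_toFinset]; exact hpL, hpR⟩
    rw [hacc]
    refine ⟨?_, fun hsub => ?_⟩
    · rcases hle with h | h
      · exact h.le
      · exact h.1.le
    · have hmono := yUtil_mono hsub ω
      rcases hle with h | h
      · exact absurd h (not_lt.2 hmono)
      · exact Finset.eq_of_subset_of_card_le hsub (by omega)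

variable [Fintype E]

theorem measurable_yUtil_accepted {I : Instance E} {R : Set (Finset (Outcome E))}
    (hR : I.IsPolicy R) {σ : Strategy E} (hσ : σ.IsMeasurable) :
    Measurable fun ω => yUtil (accepted R σ ω) ω := by
  classical
  have h : (fun ω => yUtil (accepted R σ ω) ω) = fun ω =>
      (fun (p : Finset E × Finset E) (ω : E → Utilities) =>
        if p.1 ⊆ p.2 ∧ outcomes p.1 ω ∈ R then yUtil p.1 ω else 0)
        (σ.proposal ω, σ.probed ω) ω := by
    funext ω
    simp only [accepted]
    split_ifs with h
    · rfl
    · simp [yUtil]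
  rw [h]
  refine measurable_comp_fiber (F := fun ω => (σ.proposal ω, σ.probed ω))
    (Φ := fun (p : Finset E × Finset E) (ω : E → Utilities) =>
      if p.1 ⊆ p.2 ∧ outcomes p.1 ω ∈ R then yUtil p.1 ω else 0) (fun p => ?_) fun p => ?_
  · have : {ω | (σ.proposal ω, σ.probed ω) = p} = {ω | σ.proposal ω = p.1} ∩ {ω | σ.probed ω = p.2} := by
      ext ω
      simp [Prod.ext_iff]
    rw [this]
    exact (hσ.2 _).inter (hσ.1 _)
  · refine Measurable.ite ?_ (measurable_yUtil _) measurable_const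
    exact (MeasurableSet.const (p.1 ⊆ p.2)).inter (hR.2 p.1)

theorem exists_agentResponse {I : Instance E} {R : Set (Finset (Outcome E))}
    (hR : I.IsPolicy R) {S : Finset E} (hS : I.outer.feasible S) (hRS : relevant R ⊆ S) :
    ∃ σ, I.IsAgentResponse R σ := by
  obtain ⟨σ, hσ, hprobed, hopt⟩ := exists_optimal_strategy hR hS hRS
  refine ⟨σ, ⟨hσ, fun τ _ => lintegral_mono fun ω => yUtil_accepted_le fun G hG =>
    (hopt ω G hG).1⟩, Or.inr (Filter.Eventually.of_forall fun ω => ⟨fun e he =>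
      (hprobed ω e).1 he, fun e he hn => absurd ((hprobed ω e).2 he) hn,
      fun G _ hG => (hopt ω G hG).2⟩)⟩

theorem ae_forall_apply {E : Type*} [Fintype E] (I : Instance E) {p : E → Utilities → Prop}
    (hp : ∀ e, ∀ᵐ v ∂(I.law e : Measure Utilities), p e v) :
    ∀ᵐ ω ∂I.prob, ∀ e, p e (ω e) :=
  ae_all_iff.2 fun e =>
    (Measure.quasiMeasurePreserving_eval (μ := fun e => (I.law e : Measure Utilities)) e).ae (hp e)

/-- Every response of the agent has an inclusion-maximal acceptable set accepted. -/
theorem accepted_maximal_of_isAgentResponse {I : Instance E} {R : Set (Finset (Outcome E))}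
    (hagent : ∀ e, ∫⁻ v, (v.2 : ℝ≥0∞) ∂(I.law e : Measure Utilities) ≠ ∞)
    (hR : I.IsPolicy R) {S : Finset E} (hS : I.outer.feasible S) (hRS : relevant R ⊆ S)
    {σ : Strategy E} (hσ : I.IsAgentResponse R σ) :
    ∀ᵐ ω ∂I.prob, ∀ G, outcomes G ω ∈ R → accepted R σ ω ⊆ G → accepted R σ ω = G := by
  obtain ⟨⟨hσs, hbest⟩, hpos | hdil⟩ := hσ
  · obtain ⟨τ, hτs, -, hopt⟩ := exists_optimal_strategy hR hS hRS
    have hle : ∀ ω, yUtil (accepted R σ ω) ω ≤ yUtil (accepted R τ ω) ω := fun ω =>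
      yUtil_accepted_le fun G hG => (hopt ω G hG).1
    have hfin : I.agentValue R σ ≠ ∞ := by
      have hy : Measurable fun v : Utilities => (v.2 : ℝ≥0∞) := measurable_snd.coe_nnreal_ennreal
      have hy' : ∀ e, Measurable fun ω : E → Utilities => ((ω e).2 : ℝ≥0∞) := fun e =>
        hy.comp (measurable_pi_apply e)
      have hsum : ∫⁻ ω, yUtil (Finset.univ : Finset E) ω ∂I.prob ≠ ∞ := by
        simp only [yUtil]
        rw [lintegral_finsetSum _ fun e _ => hy' e]
        refine ENNReal.sum_ne_top.2 fun e _ => ?_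
        rw [lintegral_apply_prob I e hy]
        exact hagent e
      exact ne_top_of_le_ne_top hsum (lintegral_mono fun ω =>
        yUtil_mono (Finset.subset_univ _) ω)
    have heq := ae_eq_of_ae_le_of_lintegral_le (Filter.Eventually.of_forall hle) hfin
      (measurable_yUtil_accepted hR hτs.2).aemeasurable (hbest τ hτs)
    filter_upwards [heq, ae_forall_apply I hpos] with ω hω hωpos G hG hsub
    by_contra hne
    obtain ⟨e, heG, he⟩ := Finset.exists_of_ssubset (hsub.ssubset_of_ne hne)
    have h1 : yUtil (insert e (accepted R σ ω)) ω ≤ yUtil (accepted R σ ω) ω := by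
      rw [hω]
      exact (yUtil_mono (Finset.insert_subset heG hsub) ω).trans (hopt ω G hG).1
    have hnt : yUtil (accepted R σ ω) ω ≠ ∞ := ENNReal.sum_ne_top.2 fun _ _ => ENNReal.coe_ne_top
    unfold yUtil at h1 hnt
    rw [Finset.sum_insert he] at h1
    have h2 : ((ω e).2 : ℝ≥0∞) ≤ 0 := by
      by_contra hc
      exact absurd h1 (not_le.2 (by
        conv_lhs => rw [← zero_add (∑ e ∈ accepted R σ ω, ((ω e).2 : ℝ≥0∞))]
        exact ENNReal.add_lt_add_right hnt (not_le.1 hc)))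
    have h3 := hωpos e
    simp only [nonpos_iff_eq_zero, ENNReal.coe_eq_zero] at h2
    exact absurd h2 h3.ne'
  · filter_upwards [hdil] with ω ⟨h1, h2, h3⟩ G hG hsub
    refine h3 G (fun e he => ?_) hG hsub
    by_contra hn
    have hrel := mem_relevant_of_outcomes_mem hG he
    refine h2 e hrel hn (I.outer.down_closed _ S (Finset.insert_subset (hRS hrel) ?_) hS)
    exact fun j hj => hRS (h1 j hj)

open Classical in
theorem lintegral_le_principalValue_familyPolicy {I : Instance E}
    (hagent : ∀ e, ∫⁻ v, (v.2 : ℝ≥0∞) ∂(I.law e : Measure Utilities) ≠ ∞)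
    {S : Finset E} (hS : I.outer.feasible S) {FF : Set (Finset E)} {A : E → Set Utilities}
    (hA : ∀ e, MeasurableSet (A e)) (h0 : ∅ ∈ FF) (hFF : ∀ G ∈ FF, G ⊆ S ∧ I.inner.feasible G)
    {σ : Strategy E} (hσ : I.IsAgentResponse (familyPolicy I FF A) σ) :
    ∫⁻ ω, ∑ e ∈ S, (A e).indicator (fun v => (v.1 : ℝ≥0∞)) (ω e) *
        (if IsBlocked FF e (activeSet A ω) then 0 else 1) ∂I.prob ≤
      I.principalValue (familyPolicy I FF A) σ := by
  have hFi := fun G hG => (hFF G hG).2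
  refine lintegral_mono_ae ?_
  filter_upwards [accepted_maximal_of_isAgentResponse hagent (isPolicy_familyPolicy hFi hA) hS
    (relevant_familyPolicy_subset fun G hG => (hFF G hG).1) hσ,
    ae_forall_apply I fun e => Measure.support_mem_ae] with ω hmax hsupp
  set G := accepted (familyPolicy I FF A) σ ω with hG
  have hGF : G ∈ FF ∧ ∀ e ∈ G, ω e ∈ A e := by
    rcases accepted_eq_empty_or (familyPolicy I FF A) σ ω with h | h
    · rw [hG, h]
      exact ⟨h0, by simp⟩
    · rw [outcomes_mem_familyPolicy hFi] at h
      exact ⟨h.1, fun e he => (h.2 e he).1⟩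
  have hmem : ∀ e, ω e ∈ A e → ¬ IsBlocked FF e (activeSet A ω) → e ∈ G := by
    intro e heA hb
    by_contra he
    have hins : insert e G ∈ FF := by
      by_contra hn
      refine hb ⟨G, hGF.1, fun j hj => Finset.mem_erase.2 ⟨?_, mem_activeSet.2 (hGF.2 j hj)⟩, hn⟩
      rintro rfl
      exact he hj
    have := hmax (insert e G) ((outcomes_mem_familyPolicy hFi).2 ⟨hins, fun j hj => ⟨?_, hsupp j⟩⟩)
      (Finset.subset_insert e G)
    · exact he (this ▸ Finset.mem_insert_self e G)
    · rcases Finset.mem_insert.1 hj with rfl | hj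
      · exact heA
      · exact hGF.2 j hj
  calc ∑ e ∈ S, (A e).indicator (fun v => (v.1 : ℝ≥0∞)) (ω e) *
        (if IsBlocked FF e (activeSet A ω) then 0 else 1)
      ≤ ∑ e ∈ S, if e ∈ G then ((ω e).1 : ℝ≥0∞) else 0 := by
        refine Finset.sum_le_sum fun e _ => ?_
        by_cases heA : ω e ∈ A e
        · rw [Set.indicator_of_mem heA]
          by_cases hb : IsBlocked FF e (activeSet A ω)
          · simp [hb]
          · simp [hb, hmem e heA hb]
        · simp [heA]
    _ ≤ xUtil G ω := by
        rw [← Finset.sum_filter, xUtil]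
        exact Finset.sum_le_sum_of_subset fun e he => (Finset.mem_filter.1 he).2

end Policy

section Main

variable {E : Type*}

open Classical in
/-- The utilities of the principal, restricted to the elements that can be both probed and
accepted. -/
noncomputable def usableWeight (I : Instance E) (e : E) (v : Utilities) : ℝ≥0 :=
  if I.outer.feasible {e} ∧ I.inner.feasible {e} then v.1 else 0

theorem usableWeight_le (I : Instance E) (e : E) (v : Utilities) : usableWeight I e v ≤ v.1 := by
  unfold usableWeight
  split_ifs <;> simp

theorem measurable_usableWeight (I : Instance E) (e : E) : Measurable (usableWeight I e) := by
  unfold usableWeight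
  split_ifs
  · exact measurable_fst
  · exact measurable_const

variable [Fintype E] [DecidableEq E]

theorem u_probed_le_weightedRank {I : Instance E} {σ : Strategy E} (hσ : I.IsStrategy σ)
    (ω : E → Utilities) : I.u (σ.probed ω) ω ≤
      (weightedRank I.inner (fun e => usableWeight I e (ω e)) (σ.probed ω) : ℝ≥0∞) := by
  refine iSup₂_le fun G hG => ?_
  refine le_trans (le_of_eq ?_) (ENNReal.coe_le_coe.2 (sum_le_weightedRank hG.1 hG.2))
  rw [xUtil, ENNReal.ofNNReal_finsetSum]
  refine Finset.sum_congr rfl fun e he => ?_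
  have hu : I.outer.feasible {e} ∧ I.inner.feasible {e} :=
    ⟨I.outer.down_closed _ _ (Finset.singleton_subset_iff.2 (hG.1 he)) (hσ.feasible_probed ω),
      I.inner.down_closed _ _ (Finset.singleton_subset_iff.2 he) hG.2⟩
  rw [usableWeight, if_pos hu]

theorem nonDelegatedValue_le (I : Instance E) (hout : I.outer.IsMatroid)
    (hin : I.inner.IsMatroid)
    (hfin : ∀ e, ∫⁻ v, (usableWeight I e v : ℝ≥0∞) ∂(I.law e : Measure Utilities) ≠ ∞) :
    ∃ S, I.outer.feasible S ∧ ENNReal.ofReal (1 - 1 / Real.exp 1) * I.nonDelegatedValue ≤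
      expectedRank I (usableWeight I) S := by
  classical
  obtain ⟨S, hS, hmax⟩ := Finset.exists_max_image (Finset.univ.filter I.outer.feasible)
    (expectedRank I (usableWeight I)) ⟨∅, by simpa using I.outer.empty_feasible⟩
  refine ⟨S, (Finset.mem_filter.1 hS).2, ?_⟩
  rw [Instance.nonDelegatedValue]
  simp only [ENNReal.mul_iSup]
  refine iSup₂_le fun σ hσ => ?_
  obtain ⟨T, hT, hle⟩ := exists_nonadaptive I hout hin (measurable_usableWeight I) hfin hσ
  refine le_trans ?_ (hle.trans (hmax T (by simpa using hT)))
  gcongr with ω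
  exact u_probed_le_weightedRank hσ ω

open Classical in
theorem isAlphaPolicy_familyPolicy {I : Instance E}
    (hagent : ∀ e, ∫⁻ v, (v.2 : ℝ≥0∞) ∂(I.law e : Measure Utilities) ≠ ∞)
    {S : Finset E} (hS : I.outer.feasible S) {FF : Set (Finset E)} {A : E → Set Utilities}
    (hA : ∀ e, MeasurableSet (A e)) (h0 : ∅ ∈ FF) (hFF : ∀ G ∈ FF, G ⊆ S ∧ I.inner.feasible G)
    {α : ℝ} (h : ENNReal.ofReal α * I.nonDelegatedValue ≤
      ∫⁻ ω, ∑ e ∈ S, (A e).indicator (fun v => (v.1 : ℝ≥0∞)) (ω e) *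
        (if IsBlocked FF e (activeSet A ω) then 0 else 1) ∂I.prob) :
    I.IsAlphaPolicy α (familyPolicy I FF A) := by
  have hP := isPolicy_familyPolicy (I := I) (fun G hG => (hFF G hG).2) hA
  exact ⟨hP, exists_agentResponse hP hS
    (relevant_familyPolicy_subset fun G hG => (hFF G hG).1),
    fun σ hσ => h.trans (lintegral_le_principalValue_familyPolicy hagent hS hA h0 hFF hσ)⟩

end Main
end Delegation

open Delegation in
theorem mainTheorem7 {E : Type*} [Fintype E] [DecidableEq E] (I : Delegation.Instance E)
    (hagent : ∀ e, ∫⁻ v, (v.2 : ℝ≥0∞) ∂(I.law e : Measure Delegation.Utilities) ≠ ∞)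
    (hout : I.outer.IsMatroid) (hin : I.inner.IsMatroid) :
    ∃ R : Set (Finset (Delegation.Outcome E)),
      I.IsAlphaPolicy (1 / 4 * (1 - 1 / Real.exp 1)) R := by
  classical
  by_cases hfin : ∀ e, ∫⁻ v, (usableWeight I e v : ℝ≥0∞) ∂(I.law e : Measure Utilities) ≠ ∞
  · obtain ⟨S, hS, hSle⟩ := nonDelegatedValue_le I hout hin hfin
    obtain ⟨FF, A, h0, hFF, hA, hle⟩ := exists_acceptance I hin (measurable_usableWeight I) hfin S
    refine ⟨familyPolicy I FF A, isAlphaPolicy_familyPolicy hagent hS hA h0 hFF ?_⟩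
    rw [ENNReal.ofReal_mul (by norm_num), mul_assoc]
    refine (mul_le_mul_right hSle _).trans (hle.trans (lintegral_mono fun ω => ?_))
    refine Finset.sum_le_sum fun e _ => mul_le_mul_left ?_ _
    exact Set.indicator_le_indicator (ENNReal.coe_le_coe.2 (usableWeight_le I e (ω e)))
  · push Not at hfin
    obtain ⟨e, he⟩ := hfin
    have hu : I.outer.feasible {e} ∧ I.inner.feasible {e} := by
      by_contra hn
      simp [usableWeight, hn] at he
    refine ⟨familyPolicy I {∅, {e}} fun _ => Set.univ, isAlphaPolicy_familyPolicy hagent hu.1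
      (fun _ => MeasurableSet.univ) (Or.inl rfl) ?_ ?_⟩
    · rintro G (rfl | rfl)
      · exact ⟨Finset.empty_subset _, I.inner.empty_feasible⟩
      · exact ⟨subset_rfl, hu.2⟩
    · have hb : ∀ Q, ¬ IsBlocked {∅, {e}} e Q := by
        rintro Q ⟨G, rfl | rfl, hGQ, hG⟩
        · exact hG (Or.inr rfl)
        · exact Finset.notMem_erase e Q (hGQ (Finset.mem_singleton_self e))
      have hx := lintegral_apply_prob I e
        (measurable_fst.coe_nnreal_ennreal : Measurable fun v : Utilities => (v.1 : ℝ≥0∞))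
      simp only [usableWeight, if_pos hu] at he
      simp [hb, hx, he]
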